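/- **Setting (continuous $K$-Max bandit, value-index feedback).** Let $1<K<N$ and $T\ge 1$. Arm $i\in[N]$ has a continuous outcome distribution $D_i$ supported on $[0,1]$ whose CDF $F_i$ satisfies, for a constant $L\ge 1$, $\frac1L(u-v)\le F_i(u)-F_i(v)\le L(u-v)$ for all $0\le v<u\le 1$. In round $t$ the learner chooses a set $S_t$ of $K$ arms; independent outcomes $X_i(t)\sim D_i$ (independent over $i$ and $t$) are drawn, and the learner observes $r_t=\max_{i\in S_t}X_i(t)$ and $i_t\in\arg\max_{i\in S_t}X_i(t)$ (ties broken arbitrarily). Let $r^*(S)=\mathbb E[\max_{i\in S}X_i]$ for independent $X_i\sim D_i$, and $\mathcal R(T)=\mathbb E\big[\sum_{t=1}^T(\max_{|S|=K}r^*(S)-r^*(S_t))\big]$. **Algorithm DCK-UCB.** Let $0<\varepsilon<\frac12$, $M=\lceil 1/\varepsilon\rceil$, $M_j=[(j-1)\varepsilon,j\varepsilon)$, $v_j=(j-1)\varepsilon$ for $j\in[M]$, and let $j_t$ be the index with $r_t\in M_{j_t}$. Put $C_t(i,j)=\#\{\tau\le t: i_\tau=i,\ j_\tau=j\}$ and $SC_t(i,j)=\#\{\tau\le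 t: i\in S_\tau,\ j_\tau\le j\}$. In round $t$ set $$\bar q^t_{i,j}=\min\Big\{\tfrac{C_{t-1}(i,j)}{SC_{t-1}(i,j)}+\sqrt{\tfrac{8\log(NMt)}{SC_{t-1}(i,j)}}+(K-1)\tfrac{L^4}{j^2},\,1\Big\}$$ (with $\bar q^t_{i,j}=1$ if $SC_{t-1}(i,j)=0$) and $\bar p^t_{i,j}=\bar q^t_{i,j}\prod_{j'>j}(1-\bar q^t_{i,j'})$, and play $S_t=\mathcal O(\bar p^t)$. Here $\mathcal O$ is any $(1-\varepsilon)$-approximation oracle for the discrete $K$-Max problem (such as a PTAS): for all probabilities $p=(p_{i,j})$ with $\sum_jp_{i,j}=1$ it returns a $K$-set with $\bar r(\mathcal O(p);p)\ge(1-\varepsilon)\max_{|S|=K}\bar r(S;p)$, where $\bar r(S;p)$ is the expected maximum over $i\in S$ of independent variables that equal $v_j$ with probability $p_{i,j}$. **Theorem.** Under these assumptions $$\mathcal R(T)\le 12289\sqrt{NKM^2T\log(NMT)}+T\varepsilon\big(4K^2L^4\log(M+1)+3\big)+16NM+\frac{\pi^2}{6}\Big(\log_2\sqrt{KM^2T\log(NMT)/N}+5\Big)+\frac1T,$$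 and, for a universal constant $C_0$, $\mathcal R(T)\le C_0\log(NMT)\big(\sqrt{NKM^2T}+L^4K^2T\varepsilon\big)$. Moreover, if $c_1\varepsilon_0\le\varepsilon\le c_2\varepsilon_0$ with $\varepsilon_0=L^{-2}K^{-3/4}N^{1/4}T^{-1/4}$ and constants $c_1,c_2>0$, then $$\mathcal R(T)\le C(c_1,c_2)\,\log(LNKT)\;L^2N^{1/4}K^{5/4}T^{3/4},$$ where $C(c_1,c_2)$ depends only on $c_1,c_2$; that is, $\mathcal R(T)=\widetilde O(L^2N^{1/4}K^{5/4}T^{3/4})$. -/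

import Mathlib

open MeasureTheory ProbabilityTheory

noncomputable section

namespace KMaxBandit

/-- The largest of the numbers `x i`, `i ∈ S` (used for nonempty `S` only). -/
def maxOver {N : ℕ} (S : Finset (Fin N)) (x : Fin N → ℝ) : ℝ := ⨆ i : S, x i

/-! ### The continuous `K`-Max bandit -/

/-- A continuous distribution on `[0, 1]` whose CDF is bi-Lipschitz on `[0, 1]` with constant `L`. -/
structure BiLipschitzOutcome (L : ℝ) (ν : Measure ℝ) : Prop where
  support : ν (Set.Icc 0 1)ᶜ = 0
  noAtoms : ∀ x, ν {x} = 0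
  lower : ∀ v u : ℝ, 0 ≤ v → v < u → u ≤ 1 → 1 / L * (u - v) ≤ cdf ν u - cdf ν v
  upper : ∀ v u : ℝ, 0 ≤ v → v < u → u ≤ 1 → cdf ν u - cdf ν v ≤ L * (u - v)

/-- `r*(S)`: expected maximum of independent outcomes `X i ∼ D i`, `i ∈ S`. -/
def expReward {N : ℕ} (D : Fin N → Measure ℝ) (S : Finset (Fin N)) : ℝ :=
  ∫ x, maxOver S x ∂(Measure.pi D)

/-- `r*(S*)`: the largest expected reward of a `K`-element action. -/
def optReward {N : ℕ} (D : Fin N → Measure ℝ) (K : ℕ) : ℝ :=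
  ⨆ S : {S : Finset (Fin N) // S.card = K}, expReward D S

/-- Environment: outcomes `X t i` of arm `i` in round `t + 1`, independent over all rounds and arms
and with law `D i`. If action `S` is played in round `t + 1`, the index fed back is `win t S`, some
arm of `S` with the largest outcome; ties are broken in any measurable way. -/
structure IsEnvironment {N : ℕ} {Ω : Type*} [MeasurableSpace Ω] (μ : Measure Ω)
    (D : Fin N → Measure ℝ) (X : ℕ → Fin N → Ω → ℝ) (win : ℕ → Finset (Fin N) → Ω → Fin N) :
    Prop where
  measurable_outcome : ∀ t i, Measurable (X t i)
  law_outcome : ∀ t i, μ.map (X t i) = D i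
  indep_outcome : iIndepFun (fun p : ℕ × Fin N => X p.1 p.2) μ
  measurable_win : ∀ t S, Measurable (win t S)
  win_mem : ∀ t S ω, S.Nonempty → win t S ω ∈ S
  win_max : ∀ t S ω, ∀ k ∈ S, X t k ω ≤ X t (win t S ω) ω

/-! ### Discretization. Bins are numbered from `0`: bin `j : Fin M` here is bin `j + 1` in the
usual numbering from `1` to `M`. -/

/-- The number of bins, `M = ⌈1 / ε⌉`. -/
def numBins (ε : ℝ) : ℕ := ⌈1 / ε⌉₊

/-- The bin `[j ε, (j + 1) ε)`; its representative value is `j ε`. -/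
def bin (ε : ℝ) (j : ℕ) : Set ℝ := Set.Ico (j * ε) ((j + 1) * ε)

/-- `p i j` is the probability that the discrete outcome of arm `i` is the value of bin `j`. -/
def IsProbSet {N M : ℕ} (p : Fin N → Fin M → ℝ) : Prop :=
  (∀ i j, 0 ≤ p i j) ∧ ∀ i, ∑ j, p i j = 1

/-- Expected maximum, over the arms of `S`, of independent discrete outcomes taking the
value `j ε` with probability `p i j`. -/
def discReward {N M : ℕ} (ε : ℝ) (p : Fin N → Fin M → ℝ) (S : Finset (Fin N)) : ℝ :=
  ∑ x : S → Fin M, (∏ i : S, p i (x i)) * ⨆ i : S, ((x i : ℕ) : ℝ) * ε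

/-- An `α`-approximation oracle for the discrete `K`-Max problem. -/
def IsApproxOracle {N M : ℕ} (ε α : ℝ) (K : ℕ)
    (oracle : (Fin N → Fin M → ℝ) → Finset (Fin N)) : Prop :=
  ∀ p, IsProbSet p → (oracle p).card = K ∧
    ∀ S : Finset (Fin N), S.card = K → α * discReward ε p S ≤ discReward ε p (oracle p)

/-- Conversion of the parameters of the binary arms into the probabilities of the discrete arms:
`p i j = q i j * ∏_{j' > j} (1 - q i j')`. -/
def binaryToDisc {N M : ℕ} (q : Fin N → Fin M → ℝ) (i : Fin N) (j : Fin M) : ℝ :=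
  q i j * ∏ j' ∈ Finset.Ioi j, (1 - q i j')

/-! ### The algorithm -/

/-- The counters kept by the algorithm: `C i j` counts the rounds in which arm `i` won with a
value in bin `j`; `SC i j` counts those in which `i` was played and the value was in a
bin `≤ j`. -/
structure Counters (N M : ℕ) where
  C : Fin N → Fin M → ℕ
  SC : Fin N → Fin M → ℕ

/-- The exploration bonus `√(8 log (N M t) / SC)`, for `SC ≠ 0`. -/
def bonus (N M t SC : ℕ) : ℝ := √(8 * Real.log ((N : ℝ) * M * t) / SC)

/-- Optimistic estimate in round `t` from the counters after round `t - 1`. When `SC = 0` the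
bonus is `+∞`, so the value, truncated at `1`, is `1`. -/
def ucb {N M : ℕ} (K : ℕ) (L : ℝ) (t : ℕ) (c : Counters N M) (i : Fin N) (j : Fin M) : ℝ :=
  if c.SC i j = 0 then 1
  else min ((c.C i j : ℝ) / c.SC i j + bonus N M t (c.SC i j)
    + ((K : ℝ) - 1) * (L ^ 4 / ((j : ℝ) + 1) ^ 2)) 1

/-- The action chosen in round `t` from the counters after round `t - 1`. -/
def policy {N M : ℕ} (K : ℕ) (L : ℝ) (oracle : (Fin N → Fin M → ℝ) → Finset (Fin N))
    (t : ℕ) (c : Counters N M) : Finset (Fin N) :=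
  oracle (binaryToDisc (ucb K L t c))

open Classical in
/-- Update of the counters after playing `S` and receiving the value-index feedback `(r, i₀)`. -/
def Counters.update {N M : ℕ} (ε : ℝ) (c : Counters N M) (S : Finset (Fin N)) (r : ℝ)
    (i₀ : Fin N) : Counters N M where
  C i j := c.C i j + if i = i₀ ∧ r ∈ bin ε j then 1 else 0
  SC i j := c.SC i j + if i ∈ S ∧ ∃ j' ≤ j, r ∈ bin ε j' then 1 else 0

/-- Counters after `t` rounds of the algorithm, when the outcomes are `x` and the winners `w`. -/
def countersAfter {N : ℕ} (K : ℕ) (L ε : ℝ)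
    (oracle : (Fin N → Fin (numBins ε) → ℝ) → Finset (Fin N))
    (x : ℕ → Fin N → ℝ) (w : ℕ → Finset (Fin N) → Fin N) : ℕ → Counters N (numBins ε)
  | 0 => ⟨fun _ _ => 0, fun _ _ => 0⟩
  | t + 1 =>
    let c := countersAfter K L ε oracle x w t
    let S := policy K L oracle (t + 1) c
    c.update ε S (maxOver S (x t)) (w t S)

/-- The action of the algorithm in round `t + 1`. -/
def action {N : ℕ} (K : ℕ) (L ε : ℝ)
    (oracle : (Fin N → Fin (numBins ε) → ℝ) → Finset (Fin N))
    (x : ℕ → Fin N → ℝ) (w : ℕ → Finset (Fin N) → Fin N) (t : ℕ) : Finset (Fin N) :=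
  policy K L oracle (t + 1) (countersAfter K L ε oracle x w t)

/-- Regret of the algorithm in rounds `1, …, T` on one realization. -/
def pathRegret {N : ℕ} (D : Fin N → Measure ℝ) (K : ℕ) (L ε : ℝ)
    (oracle : (Fin N → Fin (numBins ε) → ℝ) → Finset (Fin N)) (T : ℕ)
    (x : ℕ → Fin N → ℝ) (w : ℕ → Finset (Fin N) → Fin N) : ℝ :=
  ∑ t ∈ Finset.range T, (optReward D K - expReward D (action K L ε oracle x w t))

end KMaxBandit

end

/-! Each arm is cut into binary arms: `trueParam` is the probability that the outcome lies in bin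
`j`, given that it is in no higher bin. The discrete reward is `ε * ∑ (1 - survival)`, hence
monotone in these parameters, and it differs from the continuous reward by at most `ε`.

The feedback gives nearly unbiased data on the binary arms. The maximum lies in a bin `≤ j` with
exactly the probability `survival q S (j + 1)`. Given this, the chance that `i` wins in bin `j` is
at most its parameter, and falls short of it only when another arm of `S` falls in the same bin.
Bi-Lipschitz CDFs bound each parameter by `L² / (j + 1)`, so the shortfall is at most `(K - 1) L⁴ /
(j + 1)²` (`pi_real_winSet_le`, `le_pi_real_winSet`). An exponential supermartingale then makes the
upper confidence bounds optimistic outside an event of probability at most `2 / t²` in round `t`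
(`IsEnvironment.measureReal_not_isGood_le`).

On the good event, optimism, the oracle guarantee and the smoothness bound
`discReward_binaryToDisc_le` reduce the regret of a round to discretization and bias terms plus
confidence widths weighted by observation probabilities (`regret_le_of_isGood`). The bias terms sum
to order `K² L⁴ ε log (M + 1)`. The weighted widths are exactly the expected increment of
`potential`, so they telescope over rounds (`IsEnvironment.integral_width_eq`), and no separate
argument for rarely observed arms is needed. The final potential is bounded for every realization by
Cauchy–Schwarz (`potential_chain_le`). The resulting bound is stronger than the three stated forms,
which follow by real arithmetic. -/

noncomputable section

namespace KMaxBandit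

/-! ### The discrete reward in terms of the binary arms -/

/-- The probability that no binary arm `(i, j)` with `i ∈ S` and `n ≤ j` is on. -/
def survival {N M : ℕ} (q : Fin N → Fin M → ℝ) (S : Finset (Fin N)) (n : ℕ) : ℝ :=
  ∏ i ∈ S, ∏ j ∈ Finset.univ.filter (fun j : Fin M => n ≤ (j : ℕ)), (1 - q i j)

lemma filter_le_eq_insert {M n : ℕ} (hn : n < M) :
    (Finset.univ.filter fun j : Fin M => n ≤ (j : ℕ))
      = insert ⟨n, hn⟩ (Finset.univ.filter fun j : Fin M => n + 1 ≤ (j : ℕ)) := by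
  ext j
  simp only [Finset.mem_filter, Finset.mem_univ, true_and, Finset.mem_insert, Fin.ext_iff]
  omega

lemma filter_lt_succ_eq_insert {M n : ℕ} (hn : n < M) :
    (Finset.univ.filter fun j : Fin M => (j : ℕ) < n + 1)
      = insert ⟨n, hn⟩ (Finset.univ.filter fun j : Fin M => (j : ℕ) < n) := by
  ext j
  simp only [Finset.mem_filter, Finset.mem_univ, true_and, Finset.mem_insert, Fin.ext_iff]
  omega

lemma filter_ge_eq_empty {M n : ℕ} (hn : M ≤ n) :
    (Finset.univ.filter fun j : Fin M => n ≤ (j : ℕ)) = ∅ := by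
  ext j
  simp only [Finset.mem_filter, Finset.mem_univ, true_and, Finset.notMem_empty, iff_false]
  omega

lemma prod_filter_le_succ {M n : ℕ} (hn : n < M) (f : Fin M → ℝ) :
    ∏ j ∈ Finset.univ.filter (fun j : Fin M => n ≤ (j : ℕ)), f j
      = f ⟨n, hn⟩ * ∏ j ∈ Finset.univ.filter (fun j : Fin M => n + 1 ≤ (j : ℕ)), f j := by
  rw [filter_le_eq_insert hn, Finset.prod_insert (by simp)]

lemma Ioi_eq_filter {M : ℕ} (j : Fin M) :
    Finset.Ioi j = Finset.univ.filter fun j' : Fin M => (j : ℕ) + 1 ≤ (j' : ℕ) := by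
  ext j'
  simp only [Finset.mem_Ioi, Finset.mem_filter, Finset.mem_univ, true_and, Fin.lt_def]
  omega

lemma survival_succ {N M n : ℕ} (hn : n < M) (q : Fin N → Fin M → ℝ) (S : Finset (Fin N)) :
    survival q S n = (∏ i ∈ S, (1 - q i ⟨n, hn⟩)) * survival q S (n + 1) := by
  simp only [survival, prod_filter_le_succ hn, Finset.prod_mul_distrib]

lemma survival_of_le {N M n : ℕ} (hn : M ≤ n) (q : Fin N → Fin M → ℝ) (S : Finset (Fin N)) :
    survival q S n = 1 := by
  simp [survival, filter_ge_eq_empty hn]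

lemma survival_nonneg {N M : ℕ} {q : Fin N → Fin M → ℝ} (h1 : ∀ i j, q i j ≤ 1)
    (S : Finset (Fin N)) (n : ℕ) : 0 ≤ survival q S n :=
  Finset.prod_nonneg fun i _ => Finset.prod_nonneg fun j _ => sub_nonneg.2 (h1 i j)

lemma survival_le_one {N M : ℕ} {q : Fin N → Fin M → ℝ} (h0 : ∀ i j, 0 ≤ q i j)
    (h1 : ∀ i j, q i j ≤ 1) (S : Finset (Fin N)) (n : ℕ) : survival q S n ≤ 1 :=
  Finset.prod_le_one (fun i _ => Finset.prod_nonneg fun j _ => sub_nonneg.2 (h1 i j))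
    fun i _ => Finset.prod_le_one (fun j _ => sub_nonneg.2 (h1 i j))
      fun j _ => by linarith [h0 i j]

lemma survival_anti {N M : ℕ} {q q' : Fin N → Fin M → ℝ} (h : ∀ i j, q i j ≤ q' i j)
    (h1 : ∀ i j, q' i j ≤ 1) (S : Finset (Fin N)) (n : ℕ) :
    survival q' S n ≤ survival q S n :=
  Finset.prod_le_prod (fun i _ => Finset.prod_nonneg fun j _ => sub_nonneg.2 (h1 i j))
    fun i _ => Finset.prod_le_prod (fun j _ => sub_nonneg.2 (h1 i j))
      fun j _ => by linarith [h i j]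

/-- A product of factors in `[0, 1]` is 1-Lipschitz in each of them. -/
lemma prod_one_sub_sub_le {ι : Type*} (S : Finset ι) {a b : ι → ℝ}
    (h0 : ∀ i, 0 ≤ a i) (hab : ∀ i, a i ≤ b i) (h1 : ∀ i, b i ≤ 1) :
    ∏ i ∈ S, (1 - a i) - ∏ i ∈ S, (1 - b i) ≤ ∑ i ∈ S, (b i - a i) := by
  classical
  induction S using Finset.induction_on with
  | empty => simp
  | insert i S hi ih =>
    rw [Finset.prod_insert hi, Finset.prod_insert hi, Finset.sum_insert hi]
    have hA1 : ∏ i ∈ S, (1 - a i) ≤ 1 :=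
      Finset.prod_le_one (fun i _ => by linarith [hab i, h1 i]) fun i _ => by linarith [h0 i]
    have hBA : ∏ i ∈ S, (1 - b i) ≤ ∏ i ∈ S, (1 - a i) :=
      Finset.prod_le_prod (fun i _ => by linarith [h1 i]) fun i _ => by linarith [hab i]
    nlinarith [h0 i, hab i, h1 i]

/-- Replace `q` by `q'` one bin at a time: `A s - A' s' = (A - A') s + A' (s - s')` with `A' ≤ 1`.
Keeping the weight `survival q` at the smaller parameters, rather than bounding it by `1`, is the
point: for the true parameters it is an observation probability. -/
lemma survival_sub_le {N M : ℕ} {q q' : Fin N → Fin M → ℝ} (h0 : ∀ i j, 0 ≤ q i j)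
    (h : ∀ i j, q i j ≤ q' i j) (h1 : ∀ i j, q' i j ≤ 1) (S : Finset (Fin N)) {n : ℕ}
    (hn : n ≤ M) :
    survival q S n - survival q' S n
      ≤ ∑ j ∈ Finset.univ.filter (fun j : Fin M => n ≤ (j : ℕ)), survival q S (j + 1) * ∑ i ∈ S, (q' i j - q i j) := by
  induction hn using Nat.decreasingInduction with
  | self => simp only [survival_of_le le_rfl, filter_ge_eq_empty le_rfl, Finset.sum_empty, sub_self, le_refl]
  | of_succ n hn ih =>
    have hn' : n < M := hn
    rw [survival_succ hn', survival_succ hn', filter_le_eq_insert hn',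
      Finset.sum_insert (by simp)]
    have hd := prod_one_sub_sub_le S (a := fun i => q i ⟨n, hn'⟩) (b := fun i => q' i ⟨n, hn'⟩)
      (fun i => h0 i _) (fun i => h i _) (fun i => h1 i _)
    have hs0 : 0 ≤ survival q S (n + 1) := survival_nonneg (fun i j => (h i j).trans (h1 i j)) S _
    have hs := survival_anti h h1 S (n + 1)
    have hb1 : ∏ i ∈ S, (1 - q' i ⟨n, hn'⟩) ≤ 1 :=
      Finset.prod_le_one (fun i _ => by linarith [h1 i ⟨n, hn'⟩])
        fun i _ => by linarith [h0 i ⟨n, hn'⟩, h i ⟨n, hn'⟩]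
    simp only
    nlinarith [mul_le_mul_of_nonneg_left hd hs0,
      mul_le_mul_of_nonneg_right hb1 (sub_nonneg.2 hs)]

/-- The sum telescopes from the bottom. The parameter `1` in bin `0` makes the empty sum match a
vanishing product, and so makes the total mass `1`. -/
lemma sum_binaryToDisc {N M : ℕ} (q : Fin N → Fin M → ℝ) (i : Fin N)
    (hq : ∀ j : Fin M, (j : ℕ) = 0 → q i j = 1) (hM : 0 < M) {n : ℕ} (hn : n ≤ M) :
    ∑ j ∈ Finset.univ.filter (fun j : Fin M => (j : ℕ) < n), binaryToDisc q i j
      = ∏ j ∈ Finset.univ.filter (fun j : Fin M => n ≤ (j : ℕ)), (1 - q i j) := by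
  induction n with
  | zero =>
    rw [prod_filter_le_succ hM, hq ⟨0, hM⟩ rfl]
    simp
  | succ n ih =>
    rw [filter_lt_succ_eq_insert (by omega), Finset.sum_insert (by simp), ih (by omega),
      prod_filter_le_succ (n := n) (by omega), binaryToDisc, Ioi_eq_filter]
    ring

lemma isProbSet_binaryToDisc {N M : ℕ} {q : Fin N → Fin M → ℝ} (h0 : ∀ i j, 0 ≤ q i j)
    (h1 : ∀ i j, q i j ≤ 1) (hq : ∀ i (j : Fin M), (j : ℕ) = 0 → q i j = 1) (hM : 0 < M) :
    IsProbSet (binaryToDisc q) := by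
  refine ⟨fun i j => mul_nonneg (h0 i j)
    (Finset.prod_nonneg fun j' _ => sub_nonneg.2 (h1 i j')), fun i => ?_⟩
  have := sum_binaryToDisc q i (hq i) hM le_rfl
  rw [filter_ge_eq_empty le_rfl, Finset.prod_empty] at this
  rw [← this]
  congr 1
  ext j
  simp

/-- Layer-cake form of the maximum: `ε` times the number of thresholds reached. The event "threshold
not reached" is a product over the arms, so expectations factor by independence. -/
lemma iSup_bin_eq {M : ℕ} {ι : Type*} [Fintype ι] (ε : ℝ) (hε : 0 ≤ ε) (x : ι → Fin M) :
    ⨆ i, ((x i : ℕ) : ℝ) * ε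
      = ε * ∑ n ∈ Finset.Ico 1 M, (1 - ∏ i, if (x i : ℕ) < n then (1 : ℝ) else 0) := by
  classical
  -- For empty `ι` the real supremum is `0` by default and the empty product is `1`, so both sides
  -- vanish.
  rcases isEmpty_or_nonempty ι with hι | hι
  · simp
  obtain ⟨i₀, -, hi₀⟩ := Finset.exists_max_image Finset.univ (fun i => (x i : ℕ))
    Finset.univ_nonempty
  have h1 : ⨆ i, ((x i : ℕ) : ℝ) * ε = ((x i₀ : ℕ) : ℝ) * ε := by
    refine le_antisymm (ciSup_le fun i => ?_)
      (le_ciSup (f := fun i => ((x i : ℕ) : ℝ) * ε) (Set.finite_range _).bddAbove i₀)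
    have := hi₀ i (Finset.mem_univ i)
    gcongr
  have h2 : ∀ n ∈ Finset.Ico 1 M, (1 - ∏ i, if (x i : ℕ) < n then (1 : ℝ) else 0)
      = if n ≤ (x i₀ : ℕ) then 1 else 0 := by
    intro n _
    split_ifs with h
    · rw [Finset.prod_eq_zero (Finset.mem_univ i₀) (by simp [h])]
      simp
    · rw [Finset.prod_eq_one, sub_self]
      intro i _
      have := hi₀ i (Finset.mem_univ i)
      rw [if_pos (by omega)]
  rw [h1, Finset.sum_congr rfl h2, ← Finset.sum_filter, Finset.sum_const, nsmul_eq_mul, mul_one,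
    mul_comm]
  have h3 : (Finset.Ico 1 M).filter (fun n => n ≤ (x i₀ : ℕ)) = Finset.Icc 1 (x i₀ : ℕ) := by
    ext n
    have := (x i₀).2
    simp only [Finset.mem_filter, Finset.mem_Ico, Finset.mem_Icc]
    omega
  rw [h3, Nat.card_Icc, Nat.add_sub_cancel]

lemma discReward_eq {N M : ℕ} {ε : ℝ} (hε : 0 ≤ ε) {p : Fin N → Fin M → ℝ}
    (hp : ∀ i, ∑ j, p i j = 1) (S : Finset (Fin N)) :
    discReward ε p S
      = ε * ∑ n ∈ Finset.Ico 1 M, (1 - ∏ i ∈ S, ∑ j ∈ Finset.univ.filter (fun j : Fin M => (j : ℕ) < n), p i j) := by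
  classical
  have hprod : ∀ f : S → Fin M → ℝ, ∑ x : S → Fin M, ∏ i, f i (x i) = ∏ i, ∑ j, f i j :=
    fun f => (Fintype.prod_sum f).symm
  have h1 : ∑ x : S → Fin M, ∏ i : S, p i (x i) = 1 := by
    rw [hprod fun i j => p i j]
    exact Finset.prod_eq_one fun i _ => hp i
  have h2 : ∀ n, ∑ x : S → Fin M, (∏ i : S, p i (x i)) * ∏ i, (if (x i : ℕ) < n then (1 : ℝ) else 0)
      = ∏ i ∈ S, ∑ j ∈ Finset.univ.filter (fun j : Fin M => (j : ℕ) < n), p i j := by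
    intro n
    simp_rw [← Finset.prod_mul_distrib]
    rw [hprod fun i j => p i j * if (j : ℕ) < n then (1 : ℝ) else 0,
      ← Finset.prod_coe_sort S fun i => ∑ j ∈ Finset.univ.filter (fun j : Fin M => (j : ℕ) < n), p i j]
    refine Finset.prod_congr rfl fun i _ => ?_
    rw [Finset.sum_filter]
    exact Finset.sum_congr rfl fun j _ => by split_ifs <;> simp
  unfold discReward
  simp_rw [iSup_bin_eq ε hε, ← h2]
  have h3 : ∀ n, 1 - ∑ x : S → Fin M, (∏ i : S, p i (x i))
        * ∏ i, (if (x i : ℕ) < n then (1 : ℝ) else 0)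
      = ∑ x : S → Fin M, (∏ i : S, p i (x i))
        * (1 - ∏ i, (if (x i : ℕ) < n then (1 : ℝ) else 0)) := by
    intro n
    simp_rw [mul_sub, mul_one, Finset.sum_sub_distrib, h1]
  simp_rw [h3]
  rw [Finset.sum_comm, Finset.mul_sum]
  refine Finset.sum_congr rfl fun x _ => ?_
  rw [← Finset.mul_sum]
  ring

lemma discReward_binaryToDisc {N M : ℕ} {ε : ℝ} (hε : 0 ≤ ε) {q : Fin N → Fin M → ℝ}
    (h0 : ∀ i j, 0 ≤ q i j) (h1 : ∀ i j, q i j ≤ 1)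
    (hq : ∀ i (j : Fin M), (j : ℕ) = 0 → q i j = 1) (hM : 0 < M) (S : Finset (Fin N)) :
    discReward ε (binaryToDisc q) S = ε * ∑ n ∈ Finset.Ico 1 M, (1 - survival q S n) := by
  rw [discReward_eq hε (isProbSet_binaryToDisc h0 h1 hq hM).2]
  congr 1
  refine Finset.sum_congr rfl fun n hn => ?_
  rw [survival]
  congr 1
  exact Finset.prod_congr rfl fun i _ =>
    sum_binaryToDisc q i (hq i) hM (Finset.mem_Ico.1 hn).2.le

lemma discReward_binaryToDisc_mono {N M : ℕ} {ε : ℝ} (hε : 0 ≤ ε) {q q' : Fin N → Fin M → ℝ}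
    (h0 : ∀ i j, 0 ≤ q i j) (h : ∀ i j, q i j ≤ q' i j) (h1 : ∀ i j, q' i j ≤ 1)
    (hq : ∀ i (j : Fin M), (j : ℕ) = 0 → q i j = 1) (hM : 0 < M) (S : Finset (Fin N)) :
    discReward ε (binaryToDisc q) S ≤ discReward ε (binaryToDisc q') S := by
  have hq' : ∀ i (j : Fin M), (j : ℕ) = 0 → q' i j = 1 := fun i j hj =>
    le_antisymm (h1 i j) ((hq i j hj).symm.le.trans (h i j))
  rw [discReward_binaryToDisc hε h0 (fun i j => (h i j).trans (h1 i j)) hq hM,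
    discReward_binaryToDisc hε (fun i j => (h0 i j).trans (h i j)) h1 hq' hM]
  have := fun n => survival_anti h h1 S n
  gcongr
  exact this _

/-- Smoothness of the reward in the binary parameters, each modulated by the probability that the
true maximum is in no higher bin. -/
lemma discReward_binaryToDisc_le {N M : ℕ} {ε : ℝ} (hε : 0 ≤ ε) {q q' : Fin N → Fin M → ℝ}
    (h0 : ∀ i j, 0 ≤ q i j) (h : ∀ i j, q i j ≤ q' i j) (h1 : ∀ i j, q' i j ≤ 1)
    (hq : ∀ i (j : Fin M), (j : ℕ) = 0 → q i j = 1) (hM : 0 < M) (S : Finset (Fin N)) :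
    discReward ε (binaryToDisc q') S ≤ discReward ε (binaryToDisc q) S
      + ∑ j : Fin M, (j : ℕ) * ε * (survival q S (j + 1) * ∑ i ∈ S, (q' i j - q i j)) := by
  have hq' : ∀ i (j : Fin M), (j : ℕ) = 0 → q' i j = 1 := fun i j hj =>
    le_antisymm (h1 i j) ((hq i j hj).symm.le.trans (h i j))
  rw [discReward_binaryToDisc hε h0 (fun i j => (h i j).trans (h1 i j)) hq hM,
    discReward_binaryToDisc hε (fun i j => (h0 i j).trans (h i j)) h1 hq' hM]
  set δ : Fin M → ℝ := fun j => survival q S (j + 1) * ∑ i ∈ S, (q' i j - q i j) with hδ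
  have h2 : ∑ n ∈ Finset.Ico 1 M, (survival q S n - survival q' S n)
      ≤ ∑ n ∈ Finset.Ico 1 M, ∑ j ∈ Finset.univ.filter (fun j : Fin M => n ≤ (j : ℕ)), δ j :=
    Finset.sum_le_sum fun n hn => survival_sub_le h0 h h1 S (Finset.mem_Ico.1 hn).2.le
  -- Bin `j` is counted once for each threshold `1 ≤ n ≤ j`, which gives the factor `j`, that is,
  -- the value `j ε`.
  have h3 : ∑ n ∈ Finset.Ico 1 M, ∑ j ∈ Finset.univ.filter (fun j : Fin M => n ≤ (j : ℕ)), δ j = ∑ j : Fin M, (j : ℕ) * δ j := by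
    simp_rw [Finset.sum_filter]
    rw [Finset.sum_comm]
    refine Finset.sum_congr rfl fun j _ => ?_
    rw [← Finset.sum_filter, Finset.sum_const, nsmul_eq_mul]
    congr 2
    have : (Finset.Ico 1 M).filter (fun n => n ≤ (j : ℕ)) = Finset.Icc 1 (j : ℕ) := by
      ext n
      have := j.2
      simp only [Finset.mem_filter, Finset.mem_Ico, Finset.mem_Icc]
      omega
    rw [this, Nat.card_Icc, Nat.add_sub_cancel]
  have h4 : ∑ j : Fin M, (j : ℕ) * ε * δ j = ε * ∑ j : Fin M, (j : ℕ) * δ j := by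
    rw [Finset.mul_sum]
    exact Finset.sum_congr rfl fun j _ => by ring
  rw [h4, ← h3]
  have h5 := mul_le_mul_of_nonneg_left h2 hε
  simp only [Finset.sum_sub_distrib] at h5 ⊢
  linarith

/-! ### The largest outcome of an action -/

lemma le_maxOver {N : ℕ} {S : Finset (Fin N)} (x : Fin N → ℝ) {k : Fin N} (hk : k ∈ S) :
    x k ≤ maxOver S x :=
  le_ciSup (f := fun i : S => x i) (Set.finite_range _).bddAbove ⟨k, hk⟩

lemma exists_eq_maxOver {N : ℕ} {S : Finset (Fin N)} (hS : S.Nonempty) (x : Fin N → ℝ) :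
    ∃ k ∈ S, maxOver S x = x k := by
  have : Nonempty S := hS.to_subtype
  obtain ⟨k, hk⟩ := exists_eq_ciSup_of_finite (f := fun i : S => x i)
  exact ⟨k, k.2, hk.symm⟩

lemma maxOver_lt_iff {N : ℕ} {S : Finset (Fin N)} (hS : S.Nonempty) (x : Fin N → ℝ) (a : ℝ) :
    maxOver S x < a ↔ ∀ k ∈ S, x k < a := by
  refine ⟨fun h k hk => (le_maxOver x hk).trans_lt h, fun h => ?_⟩
  obtain ⟨k, hk, e⟩ := exists_eq_maxOver hS x
  exact e ▸ h k hk

lemma maxOver_eq_of_forall_le {N : ℕ} {S : Finset (Fin N)} {x : Fin N → ℝ} {i : Fin N}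
    (hi : i ∈ S) (h : ∀ k ∈ S, x k ≤ x i) : maxOver S x = x i := by
  obtain ⟨k, hk, e⟩ := exists_eq_maxOver ⟨i, hi⟩ x
  exact le_antisymm (e ▸ h k hk) (le_maxOver x hi)

lemma measurable_maxOver {N : ℕ} (S : Finset (Fin N)) : Measurable (maxOver S) :=
  Measurable.iSup fun i : S => measurable_pi_apply (i : Fin N)

/-- Outcomes of one round that count as an observation of the binary arm `(i, j)`. -/
def obsSet {N : ℕ} (ε : ℝ) (S : Finset (Fin N)) (i : Fin N) (j : ℕ) : Set (Fin N → ℝ) :=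
  {x | i ∈ S ∧ 0 ≤ maxOver S x ∧ maxOver S x < (j + 1) * ε}

/-- Outcomes of one round in which arm `i` has a largest outcome, which is in bin `j`. -/
def winSet {N : ℕ} (ε : ℝ) (S : Finset (Fin N)) (i : Fin N) (j : ℕ) : Set (Fin N → ℝ) :=
  {x | i ∈ S ∧ (∀ k ∈ S, x k ≤ x i) ∧ maxOver S x ∈ bin ε j}

lemma measurableSet_obsSet {N : ℕ} (ε : ℝ) (S : Finset (Fin N)) (i : Fin N) (j : ℕ) :
    MeasurableSet (obsSet ε S i j) :=
  (MeasurableSet.const _).inter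
    ((measurableSet_le measurable_const (measurable_maxOver S)).inter
      (measurableSet_lt (measurable_maxOver S) measurable_const))

lemma measurableSet_winSet {N : ℕ} (ε : ℝ) (S : Finset (Fin N)) (i : Fin N) (j : ℕ) :
    MeasurableSet (winSet ε S i j) := by
  refine (MeasurableSet.const _).inter (MeasurableSet.inter ?_ ?_)
  · have : {x : Fin N → ℝ | ∀ k ∈ S, x k ≤ x i} = ⋂ k ∈ S, {x | x k ≤ x i} := by
      ext x; simp
    change MeasurableSet {x : Fin N → ℝ | ∀ k ∈ S, x k ≤ x i}
    rw [this]
    exact Finset.measurableSet_biInter _ fun k _ =>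
      measurableSet_le (measurable_pi_apply k) (measurable_pi_apply i)
  · exact measurable_maxOver S measurableSet_Ico

/-- The witness is bin `⌊r / ε⌋₊`. This matches the update rule of `SC` with `obsSet`. -/
lemma exists_bin_le_iff {M : ℕ} {ε : ℝ} (hε : 0 < ε) (r : ℝ) (j : Fin M) :
    (∃ j' ≤ j, r ∈ bin ε (j' : ℕ)) ↔ 0 ≤ r ∧ r < ((j : ℕ) + 1) * ε := by
  constructor
  · rintro ⟨j', hj', h1, h2⟩
    refine ⟨le_trans (by positivity) h1, h2.trans_le ?_⟩
    have : ((j' : ℕ) : ℝ) ≤ (j : ℕ) := by exact_mod_cast hj'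
    gcongr
  · rintro ⟨h1, h2⟩
    have hd : 0 ≤ r / ε := by positivity
    have h3 : ⌊r / ε⌋₊ < (j : ℕ) + 1 := by
      rw [Nat.floor_lt hd, div_lt_iff₀ hε]
      exact_mod_cast h2
    refine ⟨⟨⌊r / ε⌋₊, by omega⟩, Fin.mk_le_of_le_val (by omega), ?_, ?_⟩
    · have := Nat.floor_le hd
      rwa [le_div_iff₀ hε] at this
    · have := Nat.lt_floor_add_one (r / ε)
      rwa [div_lt_iff₀ hε] at this

lemma winSet_subset_obsSet {N : ℕ} {ε : ℝ} (hε : 0 < ε) (S : Finset (Fin N)) (i : Fin N)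
    (j : ℕ) : winSet ε S i j ⊆ obsSet ε S i j :=
  fun _ ⟨h1, _, h2, h3⟩ => ⟨h1, le_trans (by positivity) h2, h3⟩

/-! ### The outcome distributions on the grid -/

lemma BiLipschitzOutcome.real_Iio_zero {L : ℝ} {ν : Measure ℝ} (h : BiLipschitzOutcome L ν) :
    ν.real (Set.Iio 0) = 0 := by
  have : ν (Set.Iio 0) = 0 := by
    refine measure_mono_null (fun x hx => ?_) h.support
    simp only [Set.mem_compl_iff, Set.mem_Icc, not_and_or, not_le]
    exact Or.inl hx
  simp [Measure.real, this]

/-- Bins are half-open and the last one may stick out beyond `1`, where the Lipschitz bounds say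
nothing. Absence of atoms settles the first point, capping at `1` the second. -/
lemma BiLipschitzOutcome.real_Iio_eq_cdf {L : ℝ} {ν : Measure ℝ} [IsProbabilityMeasure ν]
    (h : BiLipschitzOutcome L ν) (a : ℝ) : ν.real (Set.Iio a) = cdf ν (min a 1) := by
  have : NullSingletonClass ν := ⟨h.noAtoms⟩
  have hge : ∀ b : ℝ, 1 ≤ b → ν.real (Set.Iic b) = 1 := by
    intro b hb
    have : ν (Set.Iic b)ᶜ = 0 := by
      refine measure_mono_null (Set.compl_subset_compl.2 fun x hx => ?_) h.support
      exact hx.2.trans hb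
    rw [Measure.real, (prob_compl_eq_zero_iff measurableSet_Iic).1 this, ENNReal.toReal_one]
  rw [measureReal_congr Iio_ae_eq_Iic, cdf_eq_real]
  rcases le_total a 1 with ha | ha
  · rw [min_eq_left ha]
  · rw [min_eq_right ha, hge a ha, hge 1 le_rfl]

/-- The probability that the outcome of arm `i` is below the left end `n ε` of bin `n`. -/
def belowProb {N : ℕ} (D : Fin N → Measure ℝ) (ε : ℝ) (i : Fin N) (n : ℕ) : ℝ :=
  (D i).real (Set.Iio (n * ε))

/-- The parameter of the binary arm `(i, j)`: the probability that the outcome of arm `i` is in bin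
`j` when it is in no higher bin. -/
def trueParam {N : ℕ} (M : ℕ) (D : Fin N → Measure ℝ) (ε : ℝ) (i : Fin N) (j : Fin M) : ℝ :=
  (belowProb D ε i (j + 1) - belowProb D ε i j) / belowProb D ε i (j + 1)

section Grid

variable {N M : ℕ} {D : Fin N → Measure ℝ} [∀ i, IsProbabilityMeasure (D i)] {ε L : ℝ}

lemma belowProb_mono (hε : 0 < ε) (i : Fin N) : Monotone (belowProb D ε i) := by
  intro a b hab
  refine measureReal_mono (Set.Iio_subset_Iio ?_)
  gcongr

lemma real_bin (hε : 0 < ε) (i : Fin N) (j : ℕ) :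
    (D i).real (bin ε j) = belowProb D ε i (j + 1) - belowProb D ε i j := by
  have hle : (j : ℝ) * ε ≤ (j + 1) * ε := by nlinarith
  have hset : bin ε j = Set.Iio ((j + 1) * ε) \ Set.Iio (j * ε) := by
    ext x
    simp only [bin, Set.mem_Ico, Set.mem_sdiff, Set.mem_Iio, not_lt, and_comm]
  rw [belowProb, belowProb, hset, measureReal_sdiff (Set.Iio_subset_Iio hle) measurableSet_Iio]
  push_cast
  rfl

omit [∀ i, IsProbabilityMeasure (D i)] in
lemma belowProb_zero (hD : ∀ i, BiLipschitzOutcome L (D i)) (i : Fin N) :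
    belowProb D ε i 0 = 0 := by
  simpa [belowProb] using (hD i).real_Iio_zero

lemma cdf_zero (hD : ∀ i, BiLipschitzOutcome L (D i)) (i : Fin N) : cdf (D i) 0 = 0 := by
  have h := (hD i).real_Iio_zero
  rwa [(hD i).real_Iio_eq_cdf, min_eq_left zero_le_one] at h

lemma div_le_belowProb (hD : ∀ i, BiLipschitzOutcome L (D i)) (hε : 0 < ε) (i : Fin N)
    {n : ℕ} (hn : 0 < n) : 1 / L * min (n * ε) 1 ≤ belowProb D ε i n := by
  rw [belowProb, (hD i).real_Iio_eq_cdf]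
  have := (hD i).lower 0 (min (n * ε) 1) le_rfl (lt_min (by positivity) one_pos)
    (min_le_right _ _)
  rwa [cdf_zero hD, sub_zero, sub_zero] at this

lemma belowProb_pos (hD : ∀ i, BiLipschitzOutcome L (D i)) (hL : 1 ≤ L) (hε : 0 < ε) (i : Fin N)
    {n : ℕ} (hn : 0 < n) : 0 < belowProb D ε i n :=
  lt_of_lt_of_le (mul_pos (by positivity) (lt_min (by positivity) one_pos))
    (div_le_belowProb hD hε i hn)

lemma belowProb_of_one_le (hD : ∀ i, BiLipschitzOutcome L (D i)) (i : Fin N)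
    {n : ℕ} (hn : 1 ≤ n * ε) : belowProb D ε i n = 1 := by
  have h1 : ∀ a : ℝ, 1 ≤ a → (D i).real (Set.Iio a) = cdf (D i) 1 := fun a ha => by
    rw [(hD i).real_Iio_eq_cdf, min_eq_right ha]
  have h2 : (fun n : ℕ => cdf (D i) n) =ᶠ[Filter.atTop] fun _ => cdf (D i) 1 := by
    filter_upwards [Filter.eventually_ge_atTop 1] with n hn
    have hn' : (1 : ℝ) ≤ n := by exact_mod_cast hn
    have : NullSingletonClass (D i) := ⟨(hD i).noAtoms⟩
    rw [← h1 n hn', cdf_eq_real, measureReal_congr Iio_ae_eq_Iic]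
  have h3 := (tendsto_cdf_atTop (D i)).comp tendsto_natCast_atTop_atTop
  have h4 := tendsto_nhds_unique (h3.congr' h2) tendsto_const_nhds
  exact (h1 _ hn).trans h4.symm

lemma trueParam_nonneg (hε : 0 < ε) (i : Fin N) (j : Fin M) : 0 ≤ trueParam M D ε i j :=
  div_nonneg (sub_nonneg.2 (belowProb_mono hε i (Nat.le_succ _))) measureReal_nonneg

omit [∀ i, IsProbabilityMeasure (D i)] in
lemma trueParam_le_one (i : Fin N) (j : Fin M) : trueParam M D ε i j ≤ 1 := by
  refine div_le_one_of_le₀ ?_ measureReal_nonneg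
  have : 0 ≤ belowProb D ε i j := measureReal_nonneg
  linarith

lemma trueParam_zero (hD : ∀ i, BiLipschitzOutcome L (D i)) (hL : 1 ≤ L) (hε : 0 < ε)
    (i : Fin N) (j : Fin M) (hj : (j : ℕ) = 0) : trueParam M D ε i j = 1 := by
  rw [trueParam, hj, belowProb_zero hD, sub_zero, div_self]
  exact (belowProb_pos hD hL hε i (by omega)).ne'

lemma trueParam_mul (hD : ∀ i, BiLipschitzOutcome L (D i)) (hL : 1 ≤ L) (hε : 0 < ε)
    (i : Fin N) (j : Fin M) :
    trueParam M D ε i j * belowProb D ε i (j + 1) = (D i).real (bin ε j) := by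
  rw [real_bin hε, trueParam, div_mul_cancel₀]
  exact (belowProb_pos hD hL hε i (by omega)).ne'

/-- The bin has mass at most `L ε`, while the mass below its right end is at least `(j + 1) ε / L`.
For the last bin the right end is capped at `1`, and the capped length still satisfies `(u - j ε)(j
+ 1) ≤ u`. -/
lemma trueParam_le (hD : ∀ i, BiLipschitzOutcome L (D i)) (hL : 1 ≤ L) (hε : 0 < ε)
    (hM : ((M : ℝ) - 1) * ε < 1) (i : Fin N) (j : Fin M) :
    trueParam M D ε i j ≤ L ^ 2 / ((j : ℕ) + 1) := by
  have hj : ((j : ℕ) : ℝ) ≤ M - 1 := by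
    have := j.2
    have : ((j : ℕ) : ℝ) + 1 ≤ M := by exact_mod_cast this
    linarith
  have hj1 : ((j : ℕ) : ℝ) * ε < 1 := lt_of_le_of_lt (by gcongr) hM
  have hL0 : 0 < L := by linarith
  set u : ℝ := min (((j : ℕ) + 1) * ε) 1 with hu
  have hvu : ((j : ℕ) : ℝ) * ε < u := lt_min (by nlinarith) hj1
  have hup : belowProb D ε i (j + 1) - belowProb D ε i j ≤ L * (u - (j : ℕ) * ε) := by
    have := (hD i).upper ((j : ℕ) * ε) u (by positivity) hvu (min_le_right _ _)
    rw [belowProb, belowProb, (hD i).real_Iio_eq_cdf, (hD i).real_Iio_eq_cdf, min_eq_left hj1.le]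
    push_cast
    exact this
  have hlow : 1 / L * u ≤ belowProb D ε i (j + 1) := by
    have := div_le_belowProb hD hε i (n := j + 1) (by omega)
    push_cast at this
    exact this
  have hpos := belowProb_pos hD hL hε i (n := j + 1) (by omega)
  rw [trueParam, div_le_div_iff₀ hpos (by positivity)]
  have hu1 : u ≤ ((j : ℕ) + 1) * ε := min_le_left _ _
  have h1 : (u - (j : ℕ) * ε) * ((j : ℕ) + 1) ≤ u := by
    have : (0 : ℝ) ≤ (j : ℕ) := by positivity
    nlinarith
  calc (belowProb D ε i (j + 1) - belowProb D ε i j) * ((j : ℕ) + 1)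
      ≤ L * (u - (j : ℕ) * ε) * ((j : ℕ) + 1) := by gcongr
    _ ≤ L * u := by rw [mul_assoc]; gcongr
    _ = L ^ 2 * (1 / L * u) := by field_simp
    _ ≤ L ^ 2 * belowProb D ε i (j + 1) := by gcongr

/-- Each factor is a ratio of consecutive values of `belowProb`, so the product telescopes to the
top value, which is `1` because the grid covers `[0, 1]`. -/
lemma prod_one_sub_trueParam (hD : ∀ i, BiLipschitzOutcome L (D i)) (hL : 1 ≤ L) (hε : 0 < ε)
    (hM : 1 ≤ M * ε) (i : Fin N) {n : ℕ} (hn : n ≤ M) :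
    ∏ j ∈ Finset.univ.filter (fun j : Fin M => n ≤ (j : ℕ)), (1 - trueParam M D ε i j)
      = belowProb D ε i n := by
  induction hn using Nat.decreasingInduction with
  | self => rw [filter_ge_eq_empty le_rfl, Finset.prod_empty, belowProb_of_one_le hD i hM]
  | of_succ n hn ih =>
    have hpos := belowProb_pos hD hL hε i (n := n + 1) (by omega)
    rw [prod_filter_le_succ hn, ih, trueParam]
    simp only
    field_simp
    ring

lemma survival_trueParam (hD : ∀ i, BiLipschitzOutcome L (D i)) (hL : 1 ≤ L) (hε : 0 < ε)
    (hM : 1 ≤ M * ε) (S : Finset (Fin N)) {n : ℕ} (hn : n ≤ M) :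
    survival (trueParam M D ε) S n = ∏ i ∈ S, belowProb D ε i n :=
  Finset.prod_congr rfl fun i _ => prod_one_sub_trueParam hD hL hε hM i hn

/-! ### The law of one round -/

lemma ae_mem_Icc (hD : ∀ i, BiLipschitzOutcome L (D i)) :
    ∀ᵐ x ∂(Measure.pi D), ∀ i, x i ∈ Set.Icc (0 : ℝ) 1 := by
  rw [ae_all_iff]
  intro i
  have h : ∀ᵐ y ∂(D i), y ∈ Set.Icc (0 : ℝ) 1 := (hD i).support
  exact (measurePreserving_eval D i).quasiMeasurePreserving.ae h

lemma pi_real_forall_mem (S : Finset (Fin N)) (A : Fin N → Set ℝ) :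
    (Measure.pi D).real {x | ∀ k ∈ S, x k ∈ A k} = ∏ k ∈ S, (D k).real (A k) := by
  have h : {x : Fin N → ℝ | ∀ k ∈ S, x k ∈ A k} = (S : Set (Fin N)).pi A := by
    ext x; simp [Set.mem_pi]
  rw [h, Measure.real, Measure.pi_pi_finset, ENNReal.toReal_prod]
  rfl

lemma maxOver_mem_Icc {S : Finset (Fin N)} (hS : S.Nonempty) {x : Fin N → ℝ}
    (hx : ∀ i, x i ∈ Set.Icc (0 : ℝ) 1) : maxOver S x ∈ Set.Icc (0 : ℝ) 1 := by
  obtain ⟨k, -, e⟩ := exists_eq_maxOver hS x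
  exact e ▸ hx k

/-- With `survival_trueParam`, this identifies the weights of the smoothness bound with the
probabilities of observation. -/
lemma pi_real_obsSet (hD : ∀ i, BiLipschitzOutcome L (D i)) {S : Finset (Fin N)} {i : Fin N}
    (hi : i ∈ S) (j : ℕ) :
    (Measure.pi D).real (obsSet ε S i j) = ∏ k ∈ S, belowProb D ε k (j + 1) := by
  simp only [belowProb]
  rw [← pi_real_forall_mem S fun _ => Set.Iio (((j + 1 : ℕ) : ℝ) * ε)]
  refine measureReal_congr ?_
  filter_upwards [ae_mem_Icc hD] with x hx
  refine propext ?_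
  change (i ∈ S ∧ 0 ≤ maxOver S x ∧ maxOver S x < (j + 1) * ε) ↔ ∀ k ∈ S, x k < ((j + 1 : ℕ) : ℝ) * ε
  rw [maxOver_lt_iff ⟨i, hi⟩]
  push_cast
  exact ⟨fun h => h.2.2, fun h => ⟨hi, (maxOver_mem_Icc ⟨i, hi⟩ hx).1, h⟩⟩

lemma obsSet_eq_empty {S : Finset (Fin N)} {i : Fin N} (hi : i ∉ S) (j : ℕ) :
    obsSet ε S i j = ∅ :=
  Set.eq_empty_of_forall_notMem fun _ h => hi h.1

/-- Winning in bin `j` forces `i` into the bin and the other arms below its right end. This larger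
event has probability exactly the right-hand side, so winning frequencies are biased only downwards.
-/
lemma pi_real_winSet_le (hD : ∀ i, BiLipschitzOutcome L (D i)) (hL : 1 ≤ L) (hε : 0 < ε)
    (S : Finset (Fin N)) (i : Fin N) (j : Fin M) :
    (Measure.pi D).real (winSet ε S i j)
      ≤ trueParam M D ε i j * (Measure.pi D).real (obsSet ε S i j) := by
  by_cases hi : i ∈ S
  swap
  · have h := winSet_subset_obsSet hε S i j
    rw [obsSet_eq_empty hi, Set.subset_empty_iff] at h
    rw [obsSet_eq_empty hi, h]
    simp
  set A : Fin N → Set ℝ := fun k => if k = i then bin ε j else Set.Iio (((j + 1 : ℕ) : ℝ) * ε)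
    with hA
  have hsub : winSet ε S i j ⊆ {x | ∀ k ∈ S, x k ∈ A k} := by
    rintro x ⟨-, h1, h2⟩ k hk
    rw [maxOver_eq_of_forall_le hi h1] at h2
    by_cases hki : k = i
    · simp only [hA, hki, if_true]; exact h2
    · simp only [hA, hki, if_false, Set.mem_Iio]
      push_cast
      exact (h1 k hk).trans_lt h2.2
  refine (measureReal_mono hsub).trans_eq ?_
  rw [pi_real_forall_mem, pi_real_obsSet hD hi, ← Finset.mul_prod_erase S _ hi,
    ← Finset.mul_prod_erase S _ hi, ← mul_assoc, trueParam_mul hD hL hε]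
  congr 1
  · simp [hA]
  · refine Finset.prod_congr rfl fun k hk => ?_
    simp only [hA, if_neg (Finset.ne_of_mem_erase hk), belowProb]

/-- If `i` is in bin `j`, the others are below its right end and `i` still does not win, then the
arm beating it lies in the same bin. A union bound over the `K - 1` rivals, each coincidence costing
at most `(L² / (j + 1))²`, gives the bias term of the algorithm. -/
lemma le_pi_real_winSet (hD : ∀ i, BiLipschitzOutcome L (D i)) (hL : 1 ≤ L) (hε : 0 < ε)
    (hM : ((M : ℝ) - 1) * ε < 1) {K : ℕ} {S : Finset (Fin N)} (hS : S.card = K) (i : Fin N)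
    (j : Fin M) :
    (trueParam M D ε i j - ((K : ℝ) - 1) * (L ^ 4 / ((j : ℕ) + 1) ^ 2))
      * (Measure.pi D).real (obsSet ε S i j) ≤ (Measure.pi D).real (winSet ε S i j) := by
  by_cases hi : i ∈ S
  swap
  · rw [obsSet_eq_empty hi]
    simp
  set A : Fin N → Set ℝ := fun k => if k = i then bin ε j else Set.Iio (((j + 1 : ℕ) : ℝ) * ε)
    with hA
  set B : Fin N → Fin N → Set ℝ := fun l k =>
    if k = i ∨ k = l then bin ε j else Set.Iio (((j + 1 : ℕ) : ℝ) * ε) with hB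
  set a := ∏ k ∈ S, belowProb D ε k (j + 1) with ha
  have ha0 : 0 ≤ a := Finset.prod_nonneg fun _ _ => measureReal_nonneg
  set q := trueParam M D ε with hq
  have hPA : (Measure.pi D).real {x | ∀ k ∈ S, x k ∈ A k} = q i j * a := by
    rw [pi_real_forall_mem, ha, ← Finset.mul_prod_erase S _ hi,
      ← Finset.mul_prod_erase S _ hi, ← mul_assoc, hq, trueParam_mul hD hL hε]
    congr 1
    · simp [hA]
    · refine Finset.prod_congr rfl fun k hk => ?_
      simp only [hA, if_neg (Finset.ne_of_mem_erase hk), belowProb]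
  have hPB : ∀ l ∈ S.erase i, (Measure.pi D).real {x | ∀ k ∈ S, x k ∈ B l k}
      = q i j * q l j * a := by
    intro l hl
    have hli := Finset.ne_of_mem_erase hl
    rw [pi_real_forall_mem, ha, ← Finset.mul_prod_erase S _ hi, ← Finset.mul_prod_erase _ _ hl,
      ← Finset.mul_prod_erase S _ hi, ← Finset.mul_prod_erase _ _ hl]
    have e1 : (D i).real (B l i) = q i j * belowProb D ε i (j + 1) := by
      rw [hq, trueParam_mul hD hL hε]; simp [hB]
    have e2 : (D l).real (B l l) = q l j * belowProb D ε l (j + 1) := by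
      rw [hq, trueParam_mul hD hL hε]; simp [hB]
    have e3 : ∏ k ∈ (S.erase i).erase l, (D k).real (B l k)
        = ∏ k ∈ (S.erase i).erase l, belowProb D ε k (j + 1) := by
      refine Finset.prod_congr rfl fun k hk => ?_
      have h1 := Finset.ne_of_mem_erase hk
      have h2 := Finset.ne_of_mem_erase (Finset.mem_of_mem_erase hk)
      simp [hB, h1, h2, belowProb]
    rw [e1, e2, e3]
    ring
  have hcov : {x : Fin N → ℝ | ∀ k ∈ S, x k ∈ A k}
      ⊆ winSet ε S i j ∪ ⋃ l ∈ S.erase i, {x | ∀ k ∈ S, x k ∈ B l k} := by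
    intro x hx
    have hxi : x i ∈ bin ε j := by simpa [hA] using hx i hi
    by_cases hmax : ∀ k ∈ S, x k ≤ x i
    · left
      exact ⟨hi, hmax, by rwa [maxOver_eq_of_forall_le hi hmax]⟩
    · right
      push Not at hmax
      obtain ⟨l, hl, hlt⟩ := hmax
      have hli : l ≠ i := fun h => by simp [h] at hlt
      have hxl : x l < ((j + 1 : ℕ) : ℝ) * ε := by simpa [hA, hli] using hx l hl
      simp only [Set.mem_iUnion]
      refine ⟨l, Finset.mem_erase.2 ⟨hli, hl⟩, fun k hk => ?_⟩
      by_cases hki : k = i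
      · simpa [hB, hki] using hxi
      by_cases hkl : k = l
      · simp only [hB, hkl, or_true, if_true]
        exact ⟨hxi.1.trans hlt.le, by push_cast at hxl; exact hxl⟩
      · simpa [hB, hA, hki, hkl] using hx k hk
  have hq0 : ∀ k, 0 ≤ q k j := fun k => trueParam_nonneg hε k j
  have hqL : ∀ k, q k j ≤ L ^ 2 / ((j : ℕ) + 1) := fun k => trueParam_le hD hL hε hM k j
  have h1 : q i j * a ≤ (Measure.pi D).real (winSet ε S i j)
      + ∑ l ∈ S.erase i, q i j * q l j * a := by
    rw [← hPA, ← Finset.sum_congr rfl hPB]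
    refine (measureReal_mono hcov).trans ((measureReal_union_le _ _).trans ?_)
    gcongr
    exact measureReal_biUnion_finset_le _ _
  have h2 : ∑ l ∈ S.erase i, q i j * q l j * a
      ≤ ((K : ℝ) - 1) * (L ^ 4 / ((j : ℕ) + 1) ^ 2) * a := by
    have : ∀ l ∈ S.erase i, q i j * q l j * a ≤ L ^ 4 / ((j : ℕ) + 1) ^ 2 * a := by
      intro l _
      have : L ^ 4 / (((j : ℕ) : ℝ) + 1) ^ 2 = L ^ 2 / ((j : ℕ) + 1) * (L ^ 2 / ((j : ℕ) + 1)) := by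
        field_simp
      rw [this]
      gcongr
      exacts [hq0 l, hqL i, hqL l]
    refine (Finset.sum_le_sum this).trans_eq ?_
    rw [Finset.sum_const, Finset.card_erase_of_mem hi, hS, nsmul_eq_mul, Nat.cast_sub
      (hS ▸ Finset.card_pos.2 ⟨i, hi⟩)]
    push_cast
    ring
  rw [pi_real_obsSet hD hi]
  linarith

/-! ### Rewards -/

lemma integrable_maxOver (hD : ∀ i, BiLipschitzOutcome L (D i)) {S : Finset (Fin N)}
    (hS : S.Nonempty) : Integrable (maxOver S) (Measure.pi D) := by
  refine Integrable.of_mem_Icc 0 1 (measurable_maxOver S).aemeasurable ?_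
  filter_upwards [ae_mem_Icc hD] with x hx using maxOver_mem_Icc hS hx

lemma expReward_mem_Icc (hD : ∀ i, BiLipschitzOutcome L (D i)) {S : Finset (Fin N)}
    (hS : S.Nonempty) : expReward D S ∈ Set.Icc (0 : ℝ) 1 := by
  constructor
  · refine integral_nonneg_of_ae ?_
    filter_upwards [ae_mem_Icc hD] with x hx using (maxOver_mem_Icc hS hx).1
  · have : ∫ x, maxOver S x ∂(Measure.pi D) ≤ ∫ _, (1 : ℝ) ∂(Measure.pi D) := by
      refine integral_mono_ae (integrable_maxOver hD hS) (integrable_const _) ?_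
      filter_upwards [ae_mem_Icc hD] with x hx using (maxOver_mem_Icc hS hx).2
    rw [integral_const, probReal_univ, one_smul] at this
    exact this

lemma grid_count (hε : 0 < ε) (hM : 1 ≤ M * ε) {m : ℝ} (h0 : 0 ≤ m) (h1 : m ≤ 1) :
    ε * ∑ n ∈ Finset.Ico 1 M, (if m < n * ε then (0 : ℝ) else 1) ≤ m ∧
      m ≤ ε * ∑ n ∈ Finset.Ico 1 M, (if m < n * ε then (0 : ℝ) else 1) + ε := by
  have hd : 0 ≤ m / ε := by positivity
  have hM0 : 0 < M := by
    rcases Nat.eq_zero_or_pos M with h | h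
    · subst h; norm_num at hM
    · exact h
  have hset : (Finset.Ico 1 M).filter (fun n : ℕ => ¬ m < n * ε)
      = Finset.Icc 1 (min ⌊m / ε⌋₊ (M - 1)) := by
    ext n
    rw [Finset.mem_filter, Finset.mem_Ico, Finset.mem_Icc, not_lt, le_min_iff,
      Nat.le_floor_iff hd, le_div_iff₀ hε]
    constructor
    · rintro ⟨⟨h1, h2⟩, h3⟩; exact ⟨h1, h3, by omega⟩
    · rintro ⟨h1, h3, h2⟩; exact ⟨⟨h1, by omega⟩, h3⟩
  have hsum : ∑ n ∈ Finset.Ico 1 M, (if m < n * ε then (0 : ℝ) else 1)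
      = (min ⌊m / ε⌋₊ (M - 1) : ℕ) := by
    have : ∀ n : ℕ, (if m < n * ε then (0 : ℝ) else 1) = if ¬ m < n * ε then 1 else 0 := by
      intro n; split_ifs <;> simp_all
    simp_rw [this]
    rw [← Finset.sum_filter, hset, Finset.sum_const, nsmul_eq_mul, mul_one, Nat.card_Icc,
      Nat.add_sub_cancel]
  rw [hsum]
  constructor
  · have : ((min ⌊m / ε⌋₊ (M - 1) : ℕ) : ℝ) ≤ m / ε :=
      le_trans (by exact_mod_cast min_le_left _ _) (Nat.floor_le hd)
    rw [le_div_iff₀ hε] at this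
    linarith
  · rcases le_total ⌊m / ε⌋₊ (M - 1) with h | h
    · rw [min_eq_left h]
      have := Nat.lt_floor_add_one (m / ε)
      rw [div_lt_iff₀ hε] at this
      linarith
    -- All `M - 1` thresholds are reached, and `m ≤ 1 ≤ M ε` closes the gap.
    · rw [min_eq_right h, Nat.cast_sub hM0]
      push_cast
      linarith

/-- Discretization rounds the maximum down to the grid; `grid_count` gives the pointwise error,
which is then integrated. -/
lemma discReward_trueParam_bounds (hD : ∀ i, BiLipschitzOutcome L (D i)) (hL : 1 ≤ L)
    (hε : 0 < ε) (hM : 1 ≤ M * ε) (hM0 : 0 < M) {S : Finset (Fin N)} (hS : S.Nonempty) :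
    discReward ε (binaryToDisc (trueParam M D ε)) S ≤ expReward D S ∧
      expReward D S ≤ discReward ε (binaryToDisc (trueParam M D ε)) S + ε := by
  have hmeas : ∀ n : ℕ, MeasurableSet {x : Fin N → ℝ | maxOver S x < n * ε} := fun n =>
    measurableSet_lt (measurable_maxOver S) measurable_const
  have hint : ∀ n : ℕ, Integrable (fun x => if maxOver S x < n * ε then (0 : ℝ) else 1)
      (Measure.pi D) := fun n =>
    Integrable.of_mem_Icc 0 1 (Measurable.ite (hmeas n) measurable_const
      measurable_const).aemeasurable (Filter.Eventually.of_forall fun x => by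
        split_ifs <;> simp)
  have hI : ∀ n : ℕ, ∫ x, (if maxOver S x < n * ε then (0 : ℝ) else 1) ∂(Measure.pi D)
      = 1 - ∏ i ∈ S, belowProb D ε i n := by
    intro n
    have h1 : ∀ x, (if maxOver S x < n * ε then (0 : ℝ) else 1)
        = 1 - {x : Fin N → ℝ | maxOver S x < n * ε}.indicator (fun _ => (1 : ℝ)) x := by
      intro x
      by_cases h : maxOver S x < n * ε <;> simp [Set.indicator, h]
    simp_rw [h1]
    rw [integral_sub (integrable_const _) ((integrable_indicator_iff (hmeas n)).2
      (integrable_const (1 : ℝ)).integrableOn), integral_indicator_const _ (hmeas n)]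
    have h2 : {x : Fin N → ℝ | maxOver S x < n * ε}
        = {x | ∀ k ∈ S, x k ∈ (fun _ => Set.Iio ((n : ℝ) * ε)) k} := by
      ext x; exact maxOver_lt_iff hS x _
    rw [h2, pi_real_forall_mem]
    simp [belowProb]
  have hdisc : discReward ε (binaryToDisc (trueParam M D ε)) S
      = ∫ x, ε * ∑ n ∈ Finset.Ico 1 M, (if maxOver S x < n * ε then (0 : ℝ) else 1)
        ∂(Measure.pi D) := by
    rw [discReward_binaryToDisc hε.le (trueParam_nonneg hε) trueParam_le_one
      (trueParam_zero hD hL hε) hM0, integral_const_mul, integral_finsetSum _ fun n _ => hint n]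
    congr 1
    refine Finset.sum_congr rfl fun n hn => ?_
    rw [hI, survival_trueParam hD hL hε hM S (Finset.mem_Ico.1 hn).2.le]
  have hint' : Integrable (fun x => ε * ∑ n ∈ Finset.Ico 1 M,
      (if maxOver S x < n * ε then (0 : ℝ) else 1)) (Measure.pi D) :=
    (integrable_finsetSum _ fun n _ => hint n).const_mul _
  rw [hdisc, expReward]
  constructor
  · refine integral_mono_ae hint' (integrable_maxOver hD hS) ?_
    filter_upwards [ae_mem_Icc hD] with x hx
    have := maxOver_mem_Icc hS hx
    exact (grid_count hε hM this.1 this.2).1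
  · have : ε = ∫ _, ε ∂(Measure.pi D) := by simp
    refine le_of_le_of_eq ?_ ((integral_add hint' (integrable_const ε)).trans
      (congrArg _ this.symm))
    refine integral_mono_ae (integrable_maxOver hD hS) (hint'.add (integrable_const _)) ?_
    filter_upwards [ae_mem_Icc hD] with x hx
    have := maxOver_mem_Icc hS hx
    exact (grid_count hε hM this.1 this.2).2

end Grid

/-! ### The counters as a Markov chain -/

/-- The counters form a countable space, so with the discrete σ-algebra every policy is measurable
and the oracle may be arbitrary. -/
instance {N M : ℕ} : MeasurableSpace (Counters N M) := ⊤

instance {N M : ℕ} : DiscreteMeasurableSpace (Counters N M) := ⟨fun _ => trivial⟩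

instance {N M : ℕ} : Countable (Counters N M) :=
  Function.Injective.countable (f := fun c : Counters N M => (c.C, c.SC)) fun a b h => by
    cases a; cases b; simpa using h

open Classical in
/-- Update of the counters after playing `S`, as a function of the outcomes `x`. -/
def stepCounters {N M : ℕ} (ε : ℝ) (c : Counters N M) (S : Finset (Fin N)) (x : Fin N → ℝ) :
    Counters N M where
  C i j := c.C i j + if x ∈ winSet ε S i j then 1 else 0
  SC i j := c.SC i j + if x ∈ obsSet ε S i j then 1 else 0

/-- The counters after `t` rounds under the policy `pol`, when the outcomes are `x`. -/
def chain {N M : ℕ} (ε : ℝ) (pol : ℕ → Counters N M → Finset (Fin N)) (x : ℕ → Fin N → ℝ) :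
    ℕ → Counters N M
  | 0 => ⟨fun _ _ => 0, fun _ _ => 0⟩
  | t + 1 => stepCounters ε (chain ε pol x t) (pol (t + 1) (chain ε pol x t)) (x t)

lemma measurable_stepCounters {N M : ℕ} (ε : ℝ) (c : Counters N M) (S : Finset (Fin N)) :
    Measurable (stepCounters ε c S) := by
  classical
  let e : (Fin N → Fin M → ℕ) × (Fin N → Fin M → ℕ) → Counters N M := fun p => ⟨p.1, p.2⟩
  have he : Measurable e := measurable_of_countable e
  refine he.comp (Measurable.prodMk ?_ ?_)
  · exact measurable_pi_lambda _ fun i => measurable_pi_lambda _ fun j =>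
      measurable_const.add (Measurable.ite (measurableSet_winSet ε S i j) measurable_const
        measurable_const)
  · exact measurable_pi_lambda _ fun i => measurable_pi_lambda _ fun j =>
      measurable_const.add (Measurable.ite (measurableSet_obsSet ε S i j) measurable_const
        measurable_const)

lemma measurable_stepCounters_prod {N M : ℕ} (ε : ℝ) (σ : Counters N M → Finset (Fin N)) :
    Measurable fun p : Counters N M × (Fin N → ℝ) => stepCounters ε p.1 (σ p.1) p.2 := by
  refine measurable_from_prod_countable_right
    (f := fun p : Counters N M × (Fin N → ℝ) => stepCounters ε p.1 (σ p.1) p.2) fun c => ?_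
  exact measurable_stepCounters ε c (σ c)

lemma measurable_chain {N M : ℕ} (ε : ℝ) (pol : ℕ → Counters N M → Finset (Fin N)) {α : Type*}
    [MeasurableSpace α] {x : α → ℕ → Fin N → ℝ} (hx : ∀ t i, Measurable fun y => x y t i)
    (t : ℕ) : Measurable fun y => chain ε pol (x y) t := by
  induction t with
  | zero => exact measurable_const
  | succ t ih =>
    exact (measurable_stepCounters_prod ε (pol (t + 1))).comp (ih.prodMk (measurable_pi_lambda _ fun i => hx t i))

lemma chain_congr {N M : ℕ} (ε : ℝ) (pol : ℕ → Counters N M → Finset (Fin N))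
    {x x' : ℕ → Fin N → ℝ} {t : ℕ} (h : ∀ s < t, x s = x' s) :
    chain ε pol x t = chain ε pol x' t := by
  induction t with
  | zero => rfl
  | succ t ih =>
    rw [chain, chain, ih fun s hs => h s (by omega), h t (by omega)]

lemma chain_le {N M : ℕ} (ε : ℝ) (pol : ℕ → Counters N M → Finset (Fin N))
    (x : ℕ → Fin N → ℝ) (t : ℕ) (i : Fin N) (j : Fin M) :
    (chain ε pol x t).C i j ≤ t ∧ (chain ε pol x t).SC i j ≤ t := by
  induction t with
  | zero => exact ⟨le_rfl, le_rfl⟩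
  | succ t ih =>
    refine ⟨Nat.add_le_add ih.1 ?_, Nat.add_le_add ih.2 ?_⟩ <;> split_ifs <;> simp

/-- After `t` rounds the counters lie in a finite box, so every function of them is bounded, hence
integrable. -/
lemma exists_abs_chain_le {N M : ℕ} (ε : ℝ) (pol : ℕ → Counters N M → Finset (Fin N)) (t : ℕ)
    (Φ : Counters N M → ℝ) : ∃ B, ∀ x, |Φ (chain ε pol x t)| ≤ B := by
  have hfin : (Set.Icc (0 : Fin N → Fin M → ℕ) (fun _ _ => t) ×ˢ
      Set.Icc (0 : Fin N → Fin M → ℕ) (fun _ _ => t)).Finite :=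
    (Set.finite_Icc _ _).prod (Set.finite_Icc _ _)
  obtain ⟨B, hB⟩ := (hfin.image fun p => |Φ ⟨p.1, p.2⟩|).bddAbove
  refine ⟨B, fun x => hB ⟨((chain ε pol x t).C, (chain ε pol x t).SC), ⟨⟨?_, ?_⟩, ?_, ?_⟩, rfl⟩⟩
  · exact fun i j => Nat.zero_le _
  · exact fun i j => (chain_le ε pol x t i j).1
  · exact fun i j => Nat.zero_le _
  · exact fun i j => (chain_le ε pol x t i j).2

section Environment

variable {N M : ℕ} {Ω : Type*} [MeasurableSpace Ω] {μ : Measure Ω} [IsProbabilityMeasure μ]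
  {D : Fin N → Measure ℝ} [∀ i, IsProbabilityMeasure (D i)] {X : ℕ → Fin N → Ω → ℝ}
  {win : ℕ → Finset (Fin N) → Ω → Fin N} {ε L : ℝ}

omit [IsProbabilityMeasure μ] [∀ i, IsProbabilityMeasure (D i)] in
lemma IsEnvironment.measurable_chain (h : IsEnvironment μ D X win)
    (pol : ℕ → Counters N M → Finset (Fin N)) (t : ℕ) :
    Measurable fun ω => chain ε pol (fun s i => X s i ω) t :=
  KMaxBandit.measurable_chain ε pol (fun s i => h.measurable_outcome s i) t

omit [∀ i, IsProbabilityMeasure (D i)] in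
lemma IsEnvironment.integrable_comp_chain (h : IsEnvironment μ D X win)
    (pol : ℕ → Counters N M → Finset (Fin N)) (t : ℕ) (Φ : Counters N M → ℝ) :
    Integrable (fun ω => Φ (chain ε pol (fun s i => X s i ω) t)) μ := by
  obtain ⟨B, hB⟩ := exists_abs_chain_le ε pol t Φ
  refine Integrable.of_bound ?_ B (Filter.Eventually.of_forall fun ω => hB _)
  exact ((Measurable.of_discrete (f := Φ)).comp (h.measurable_chain pol t)).aestronglyMeasurable

omit [IsProbabilityMeasure μ] [∀ i, IsProbabilityMeasure (D i)] in
lemma IsEnvironment.indepFun_chain (h : IsEnvironment μ D X win)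
    (pol : ℕ → Counters N M → Finset (Fin N)) (t : ℕ) :
    IndepFun (fun ω => chain ε pol (fun s i => X s i ω) t) (fun ω i => X t i ω) μ := by
  set A : Finset (ℕ × Fin N) := Finset.range t ×ˢ Finset.univ with hA
  set B : Finset (ℕ × Fin N) := {t} ×ˢ Finset.univ with hB
  have hAB : Disjoint A B := by
    rw [Finset.disjoint_left]
    rintro ⟨s, i⟩ h1 h2
    simp only [hA, hB, Finset.mem_product, Finset.mem_range, Finset.mem_singleton] at h1 h2
    omega
  have hind := h.indep_outcome.indepFun_finset A B hAB fun p => h.measurable_outcome p.1 p.2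
  have hmB : ∀ i : Fin N, (t, i) ∈ B := fun i => by simp [hB]
  -- The state after `t` rounds depends only on earlier outcomes, so later ones may be filled with
  -- `0`.
  let φ : (A → ℝ) → ℕ → Fin N → ℝ := fun y s i => if hs : (s, i) ∈ A then y ⟨(s, i), hs⟩ else 0
  have hφ : Measurable fun y => chain ε pol (φ y) t := by
    refine KMaxBandit.measurable_chain ε pol (fun s i => ?_) t
    by_cases hs : (s, i) ∈ A
    · simp only [φ, hs, dif_pos]
      exact measurable_pi_apply _
    · simp only [φ, hs]
      exact measurable_const
  have hψ : Measurable fun (y : B → ℝ) (i : Fin N) => y ⟨(t, i), hmB i⟩ :=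
    measurable_pi_lambda _ fun i => measurable_pi_apply _
  have := hind.comp hφ hψ
  convert! this using 1
  funext ω
  refine chain_congr ε pol fun s hs => ?_
  funext i
  have : (s, i) ∈ A := by simp [hA, hs]
  simp [φ, this]

omit [IsProbabilityMeasure μ] [∀ i, IsProbabilityMeasure (D i)] in
lemma IsEnvironment.map_outcomes (h : IsEnvironment μ D X win) (t : ℕ) :
    μ.map (fun ω i => X t i ω) = Measure.pi D := by
  have h1 : iIndepFun (fun i => X t i) μ :=
    h.indep_outcome.precomp (g := fun i => (t, i)) fun a b hab => by simpa using hab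
  rw [h1.map_fun_eq_pi_map fun i => (h.measurable_outcome t i).aemeasurable]
  simp_rw [h.law_outcome]

/-- The Markov property in integrated form: independence and Fubini take the place of conditional
expectations. -/
lemma IsEnvironment.integral_chain_succ (h : IsEnvironment μ D X win)
    (pol : ℕ → Counters N M → Finset (Fin N)) (t : ℕ) (Φ : Counters N M → ℝ) :
    ∫ ω, Φ (chain ε pol (fun s i => X s i ω) (t + 1)) ∂μ
      = ∫ ω, (∫ x, Φ (stepCounters ε (chain ε pol (fun s i => X s i ω) t)
          (pol (t + 1) (chain ε pol (fun s i => X s i ω) t)) x) ∂(Measure.pi D)) ∂μ := by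
  set c : Ω → Counters N M := fun ω => chain ε pol (fun s i => X s i ω) t with hc
  have hcm : Measurable c := h.measurable_chain pol t
  have hXm : Measurable fun ω i => X t i ω := measurable_pi_lambda _ (h.measurable_outcome t)
  set F : Counters N M × (Fin N → ℝ) → ℝ := fun p =>
    Φ (stepCounters ε p.1 (pol (t + 1) p.1) p.2) with hF
  have hFm : Measurable F := (Measurable.of_discrete (f := Φ)).comp
    (measurable_stepCounters_prod ε (pol (t + 1)))
  have hjoint : μ.map (fun ω => (c ω, fun i => X t i ω)) = (μ.map c).prod (Measure.pi D) := by
    rw [← h.map_outcomes t]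
    exact (indepFun_iff_map_prod_eq_prod_map_map hcm.aemeasurable hXm.aemeasurable).1
      (h.indepFun_chain pol t)
  have h1 : ∫ ω, Φ (chain ε pol (fun s i => X s i ω) (t + 1)) ∂μ
      = ∫ p, F p ∂((μ.map c).prod (Measure.pi D)) := by
    rw [← hjoint, integral_map (hcm.prodMk hXm).aemeasurable hFm.aestronglyMeasurable]
    rfl
  have hint : Integrable F ((μ.map c).prod (Measure.pi D)) := by
    rw [← hjoint, integrable_map_measure hFm.aestronglyMeasurable (hcm.prodMk hXm).aemeasurable]
    exact h.integrable_comp_chain pol (t + 1) Φ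
  have : IsProbabilityMeasure (μ.map c) := Measure.isProbabilityMeasure_map hcm.aemeasurable
  rw [h1, integral_prod F hint, integral_map hcm.aemeasurable
    (Measurable.of_discrete (f := fun c => ∫ x, F (c, x) ∂(Measure.pi D))).aestronglyMeasurable]

/-! ### The counters of the algorithm -/

/-- Independent outcomes without atoms almost surely have no ties, so the tie-breaking rule is
immaterial and the algorithm's counters coincide with `chain`. -/
lemma IsEnvironment.ae_injective (h : IsEnvironment μ D X win)
    (hD : ∀ i, BiLipschitzOutcome L (D i)) :
    ∀ᵐ ω ∂μ, ∀ t i k, X t i ω = X t k ω → i = k := by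
  simp only [ae_all_iff]
  intro t i k
  by_cases hik : i = k
  · simp [hik]
  have hind : IndepFun (X t i) (X t k) μ :=
    h.indep_outcome.indepFun (i := (t, i)) (j := (t, k)) (by simpa using hik)
  have hmi := h.measurable_outcome t i
  have hmk := h.measurable_outcome t k
  have hjoint := (indepFun_iff_map_prod_eq_prod_map_map hmi.aemeasurable hmk.aemeasurable).1 hind
  rw [h.law_outcome, h.law_outcome] at hjoint
  have hdiag : MeasurableSet {p : ℝ × ℝ | p.1 = p.2} :=
    measurableSet_eq_fun measurable_fst measurable_snd
  have hnull : ((D i).prod (D k)) {p : ℝ × ℝ | p.1 = p.2} = 0 := by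
    rw [Measure.measure_prod_null hdiag]
    refine Filter.Eventually.of_forall fun a => ?_
    have : Prod.mk a ⁻¹' {p : ℝ × ℝ | p.1 = p.2} = {a} := by
      ext b; simp [eq_comm]
    beta_reduce
    rw [this]
    exact (hD k).noAtoms a
  rw [← hjoint, Measure.map_apply (hmi.prodMk hmk) hdiag] at hnull
  have : ∀ᵐ ω ∂μ, ¬ X t i ω = X t k ω := by
    rw [ae_iff]
    simpa using hnull
  filter_upwards [this] with ω hω h' using absurd h' hω

end Environment

lemma ucb_nonneg {N M K : ℕ} {L : ℝ} (hK : 1 < K) (t : ℕ) (c : Counters N M) (i : Fin N)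
    (j : Fin M) : 0 ≤ ucb K L t c i j := by
  unfold ucb
  split_ifs
  · exact zero_le_one
  · have hK' : (1 : ℝ) ≤ K := by exact_mod_cast hK.le
    refine le_min (add_nonneg (add_nonneg (by positivity) (Real.sqrt_nonneg _)) ?_) zero_le_one
    exact mul_nonneg (by linarith) (by positivity)

lemma ucb_le_one {N M K : ℕ} {L : ℝ} (t : ℕ) (c : Counters N M) (i : Fin N)
    (j : Fin M) : ucb K L t c i j ≤ 1 := by
  unfold ucb
  split_ifs
  · exact le_rfl
  · exact min_le_right _ _

/-- In the lowest bin the bias term alone is `(K - 1) L⁴ ≥ 1`. This is why the estimates always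
define probability distributions. -/
lemma ucb_zero {N M K : ℕ} {L : ℝ} (hK : 1 < K) (hL : 1 ≤ L) (t : ℕ) (c : Counters N M)
    (i : Fin N) (j : Fin M) (hj : (j : ℕ) = 0) : ucb K L t c i j = 1 := by
  unfold ucb
  split_ifs
  · rfl
  · refine min_eq_right ?_
    have hK' : (2 : ℝ) ≤ K := by exact_mod_cast hK
    have h1 : (1 : ℝ) ≤ L ^ 4 := one_le_pow₀ hL
    have h2 : (0 : ℝ) ≤ (c.C i j : ℝ) / c.SC i j := by positivity
    have h3 : 0 ≤ bonus N M t (c.SC i j) := Real.sqrt_nonneg _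
    rw [hj]
    norm_num
    nlinarith

lemma isProbSet_ucb {N M K : ℕ} {L : ℝ} (hK : 1 < K) (hL : 1 ≤ L) (hM : 0 < M) (t : ℕ)
    (c : Counters N M) : IsProbSet (binaryToDisc (ucb K L t c)) :=
  isProbSet_binaryToDisc (ucb_nonneg hK t c) (ucb_le_one t c) (ucb_zero hK hL t c) hM

lemma card_policy {N M K : ℕ} {L ε α : ℝ} (hK : 1 < K) (hL : 1 ≤ L) (hM : 0 < M)
    {oracle : (Fin N → Fin M → ℝ) → Finset (Fin N)} (ho : IsApproxOracle ε α K oracle) (t : ℕ)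
    (c : Counters N M) : (policy K L oracle t c).card = K :=
  (ho _ (isProbSet_ucb hK hL hM t c)).1

lemma update_eq_stepCounters {N M : ℕ} {ε : ℝ} (hε : 0 < ε) (c : Counters N M)
    {S : Finset (Fin N)} {x : Fin N → ℝ} (hx : ∀ i k, x i = x k → i = k) {i₀ : Fin N}
    (h1 : i₀ ∈ S) (h2 : ∀ k ∈ S, x k ≤ x i₀) :
    c.update ε S (maxOver S x) i₀ = stepCounters ε c S x := by
  have hw : ∀ i (j : Fin M), (i = i₀ ∧ maxOver S x ∈ bin ε j) ↔ x ∈ winSet ε S i j := by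
    intro i j
    constructor
    · rintro ⟨rfl, h⟩
      exact ⟨h1, h2, h⟩
    · rintro ⟨hi, hmax, h⟩
      exact ⟨hx _ _ (le_antisymm (h2 i hi) (hmax i₀ h1)), h⟩
  have ho : ∀ i (j : Fin M), (i ∈ S ∧ ∃ j' ≤ j, maxOver S x ∈ bin ε (j' : ℕ))
      ↔ x ∈ obsSet ε S i j := fun i j => by
    rw [exists_bin_le_iff hε]
    rfl
  rw [Counters.update, stepCounters, Counters.mk.injEq]
  constructor <;> funext i j <;> congr 1
  · by_cases h : x ∈ winSet ε S i j
    · rw [if_pos h, if_pos ((hw i j).2 h)]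
    · rw [if_neg h, if_neg (mt (hw i j).1 h)]
  · by_cases h : x ∈ obsSet ε S i j
    · rw [if_pos h, if_pos ((ho i j).2 h)]
    · rw [if_neg h, if_neg (mt (ho i j).1 h)]

lemma countersAfter_eq_chain {N K : ℕ} {L ε : ℝ} (hε : 0 < ε)
    {oracle : (Fin N → Fin (numBins ε) → ℝ) → Finset (Fin N)}
    (hne : ∀ t c, (policy K L oracle t c).Nonempty) {x : ℕ → Fin N → ℝ}
    {w : ℕ → Finset (Fin N) → Fin N} (hx : ∀ t i k, x t i = x t k → i = k)
    (h1 : ∀ t (S : Finset (Fin N)), S.Nonempty → w t S ∈ S)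
    (h2 : ∀ t S, ∀ k ∈ S, x t k ≤ x t (w t S)) (t : ℕ) :
    countersAfter K L ε oracle x w t = chain ε (policy K L oracle) x t := by
  induction t with
  | zero => rfl
  | succ t ih =>
    rw [countersAfter, chain, ih]
    exact update_eq_stepCounters hε _ (hx t) (h1 t _ (hne _ _)) (h2 t _)

/-! ### Concentration of the empirical winning frequencies -/

/-- The exponential process whose drift bounds the deviation of `C i j` from `q * SC i j`. -/
def expDeviation {N M : ℕ} (l q : ℝ) (i : Fin N) (j : Fin M) (c : Counters N M) : ℝ :=
  Real.exp (l * (c.C i j - q * c.SC i j) - l ^ 2 / 2 * c.SC i j)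

/-- An observation changes `C - q SC` by `y = 1 - q` or `y = -q`. Convexity, `exp (y l) ≤ cosh l + y
sinh l` for `|y| ≤ 1`, makes the growth factor affine in the indicators, so that it can be averaged.
-/
lemma expDeviation_stepCounters_le {N M : ℕ} {ε : ℝ} (hε : 0 < ε) {q : ℝ} (l : ℝ) (hq0 : 0 ≤ q)
    (hq1 : q ≤ 1) (i : Fin N) (j : Fin M) (c : Counters N M) (S : Finset (Fin N))
    (x : Fin N → ℝ) :
    expDeviation l q i j (stepCounters ε c S x) ≤ expDeviation l q i j c
      * (1 + (obsSet ε S i j).indicator (fun _ => (1 : ℝ)) x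
            * (Real.exp (-(l ^ 2 / 2)) * (Real.cosh l - q * Real.sinh l) - 1)
          + (winSet ε S i j).indicator (fun _ => (1 : ℝ)) x
            * (Real.exp (-(l ^ 2 / 2)) * Real.sinh l)) := by
  have key : ∀ y : ℝ, |y| ≤ 1 → Real.exp (l * (c.C i j - q * c.SC i j) - l ^ 2 / 2 * c.SC i j
        + (y * l - l ^ 2 / 2))
      ≤ Real.exp (l * (c.C i j - q * c.SC i j) - l ^ 2 / 2 * c.SC i j)
        * (Real.exp (-(l ^ 2 / 2)) * (Real.cosh l + y * Real.sinh l)) := by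
    intro y hy
    rw [Real.exp_add]
    gcongr
    rw [sub_eq_add_neg, Real.exp_add, mul_comm]
    gcongr
    exact Real.exp_mul_le_cosh_add_mul_sinh hy l
  unfold expDeviation stepCounters
  by_cases ho : x ∈ obsSet ε S i j
  · by_cases hw : x ∈ winSet ε S i j
    · simp only [ho, hw, if_true, Set.indicator_of_mem]
      have := key (1 - q) (by rw [abs_le]; constructor <;> linarith)
      convert! this using 2
      · push_cast; ring
      · ring
    · simp only [ho, hw, if_true, if_false, Set.indicator_of_mem, Set.indicator_of_notMem,
        not_false_eq_true]
      have := key (-q) (by rw [abs_le]; constructor <;> linarith)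
      convert! this using 2
      · push_cast; ring
      · ring
  · have hw : x ∉ winSet ε S i j := fun h => ho (winSet_subset_obsSet hε S i j h)
    simp [ho, hw]

section Environment

variable {N M : ℕ} {Ω : Type*} [MeasurableSpace Ω] {μ : Measure Ω} [IsProbabilityMeasure μ]
  {D : Fin N → Measure ℝ} [∀ i, IsProbabilityMeasure (D i)] {X : ℕ → Fin N → Ω → ℝ}
  {win : ℕ → Finset (Fin N) → Ω → Fin N} {ε L : ℝ}

/-- Supermartingale step. The `cosh` part is absorbed by `cosh l ≤ exp (l² / 2)`; the rest has the
sign in `hS`, which covers the upper tail for `l > 0` and the lower tail for `l < 0`. -/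
lemma integral_expDeviation_stepCounters_le (hε : 0 < ε) {q : ℝ} (l : ℝ) (hq0 : 0 ≤ q)
    (hq1 : q ≤ 1) (i : Fin N) (j : Fin M) (c : Counters N M) {S : Finset (Fin N)}
    (hS : Real.sinh l * ((Measure.pi D).real (winSet ε S i j)
      - q * (Measure.pi D).real (obsSet ε S i j)) ≤ 0) :
    ∫ x, expDeviation l q i j (stepCounters ε c S x) ∂(Measure.pi D)
      ≤ expDeviation l q i j c := by
  have hI : ∀ s : Set (Fin N → ℝ), MeasurableSet s →
      Integrable (s.indicator fun _ => (1 : ℝ)) (Measure.pi D) := fun s hs =>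
    (integrable_indicator_iff hs).2 (integrable_const (1 : ℝ)).integrableOn
  have hIo := hI _ (measurableSet_obsSet ε S i j)
  have hIw := hI _ (measurableSet_winSet ε S i j)
  set E := Real.exp (-(l ^ 2 / 2)) with hE
  have hint : Integrable (fun x => expDeviation l q i j c
      * (1 + (obsSet ε S i j).indicator (fun _ => (1 : ℝ)) x
            * (E * (Real.cosh l - q * Real.sinh l) - 1)
          + (winSet ε S i j).indicator (fun _ => (1 : ℝ)) x * (E * Real.sinh l)))
      (Measure.pi D) :=
    ((((integrable_const _).add (hIo.mul_const _))).add (hIw.mul_const _)).const_mul _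
  have hle : ∫ x, expDeviation l q i j (stepCounters ε c S x) ∂(Measure.pi D) ≤ _ :=
    integral_mono_of_nonneg (Filter.Eventually.of_forall fun x => (Real.exp_pos _).le) hint
      (Filter.Eventually.of_forall fun x =>
        expDeviation_stepCounters_le hε l hq0 hq1 i j c S x)
  refine hle.trans ?_
  rw [integral_const_mul]
  refine mul_le_of_le_one_right (Real.exp_pos _).le ?_
  have hadd : Integrable (fun x => 1 + (obsSet ε S i j).indicator (fun _ => (1 : ℝ)) x
      * (E * (Real.cosh l - q * Real.sinh l) - 1)) (Measure.pi D) :=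
    (integrable_const _).add (hIo.mul_const _)
  rw [integral_add hadd (hIw.mul_const _),
    integral_add (integrable_const _) (hIo.mul_const _), integral_mul_const, integral_mul_const,
    integral_indicator_const _ (measurableSet_obsSet ε S i j),
    integral_indicator_const _ (measurableSet_winSet ε S i j), integral_const, probReal_univ]
  simp only [smul_eq_mul, mul_one]
  have hcosh : E * Real.cosh l ≤ 1 := by
    have h1 : E * Real.cosh l ≤ E * Real.exp (l ^ 2 / 2) :=
      mul_le_mul_of_nonneg_left (Real.cosh_le_exp_half_sq l) (Real.exp_pos _).le
    rwa [hE, ← Real.exp_add, neg_add_cancel, Real.exp_zero] at h1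
  have ha : 0 ≤ (Measure.pi D).real (obsSet ε S i j) := measureReal_nonneg
  have hE0 : 0 < E := Real.exp_pos _
  nlinarith [mul_nonneg ha (sub_nonneg.2 hcosh), mul_nonneg hE0.le (neg_nonneg.2 hS)]

lemma IsEnvironment.integral_expDeviation_le_one (h : IsEnvironment μ D X win) (hε : 0 < ε)
    (pol : ℕ → Counters N M → Finset (Fin N)) {q : ℝ} (l : ℝ) (hq0 : 0 ≤ q)
    (hq1 : q ≤ 1) (i : Fin N) (j : Fin M)
    (hS : ∀ t c, Real.sinh l * ((Measure.pi D).real (winSet ε (pol t c) i j)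
      - q * (Measure.pi D).real (obsSet ε (pol t c) i j)) ≤ 0) (t : ℕ) :
    ∫ ω, expDeviation l q i j (chain ε pol (fun s i => X s i ω) t) ∂μ ≤ 1 := by
  induction t with
  | zero => simp [chain, expDeviation]
  | succ t ih =>
    rw [h.integral_chain_succ]
    refine le_trans (integral_mono_of_nonneg (Filter.Eventually.of_forall fun ω =>
      integral_nonneg fun x => (Real.exp_pos _).le) (h.integrable_comp_chain pol t _)
      (Filter.Eventually.of_forall fun ω => ?_)) ih
    exact integral_expDeviation_stepCounters_le hε l hq0 hq1 i j _ (hS _ _)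

/-- Markov's inequality for the supermartingale. Fixing the value `s` of the random count lets `l`
be tuned to `s`; the price is a union over `s`. -/
lemma IsEnvironment.measureReal_deviation_le (h : IsEnvironment μ D X win) (hε : 0 < ε)
    (pol : ℕ → Counters N M → Finset (Fin N)) {q : ℝ} (l : ℝ) (hq0 : 0 ≤ q)
    (hq1 : q ≤ 1) (i : Fin N) (j : Fin M)
    (hS : ∀ t c, Real.sinh l * ((Measure.pi D).real (winSet ε (pol t c) i j)
      - q * (Measure.pi D).real (obsSet ε (pol t c) i j)) ≤ 0) (t s : ℕ) :
    μ.real {ω | (chain ε pol (fun s i => X s i ω) t).SC i j = s ∧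
      s * l ^ 2 ≤ l * ((chain ε pol (fun s i => X s i ω) t).C i j - q * s)}
      ≤ Real.exp (-(s * l ^ 2 / 2)) := by
  have h1 := mul_meas_ge_le_integral_of_nonneg (Filter.Eventually.of_forall fun ω =>
    (Real.exp_pos _).le) (h.integrable_comp_chain pol t (ε := ε) (expDeviation l q i j))
    (Real.exp (s * l ^ 2 / 2))
  have h2 := h1.trans (h.integral_expDeviation_le_one hε pol l hq0 hq1 i j hS t)
  rw [Real.exp_neg, ← one_div, le_div_iff₀ (Real.exp_pos _), mul_comm]
  refine le_trans (mul_le_mul_of_nonneg_left (measureReal_mono ?_) (Real.exp_pos _).le) h2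
  rintro ω ⟨e, hω⟩
  refine Real.exp_le_exp.2 ?_
  rw [e]
  linarith

/-- The confidence bounds used in round `t` hold for all binary arms. -/
def IsGood (K : ℕ) (L ε : ℝ) (D : Fin N → Measure ℝ) (t : ℕ) (c : Counters N M) : Prop :=
  ∀ i j, c.SC i j ≠ 0 →
    (c.C i j : ℝ) / c.SC i j ≤ trueParam M D ε i j + bonus N M t (c.SC i j) ∧
    trueParam M D ε i j ≤ (c.C i j : ℝ) / c.SC i j + bonus N M t (c.SC i j)
      + ((K : ℝ) - 1) * (L ^ 4 / ((j : ℝ) + 1) ^ 2)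

lemma exp_neg_mul_bonus_sq {t s : ℕ} (hNM : 1 ≤ (N : ℝ) * M * t) (hs : s ≠ 0) :
    Real.exp (-(s * bonus N M t s ^ 2 / 2)) = (((N : ℝ) * M * t) ^ 4)⁻¹ := by
  have hs' : (s : ℝ) ≠ 0 := by exact_mod_cast hs
  have hlog := Real.log_nonneg hNM
  rw [bonus, Real.sq_sqrt (by positivity), Real.exp_neg]
  congr 1
  have : (s : ℝ) * (8 * Real.log ((N : ℝ) * M * t) / s) / 2
      = (4 : ℕ) * Real.log ((N : ℝ) * M * t) := by
    push_cast; field_simp; ring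
  rw [this, Real.exp_nat_mul, Real.exp_log (by linarith)]

/-- Union over two tails and the `N M t` triples (arm, bin, count), each of probability at most `(N
M (t + 1))⁻⁴` by taking `l` to be plus or minus the bonus. The lower tail is centred at the
parameter minus the bias. -/
lemma IsEnvironment.measureReal_not_isGood_le (h : IsEnvironment μ D X win)
    (hD : ∀ i, BiLipschitzOutcome L (D i)) (hL : 1 ≤ L) (hε : 0 < ε)
    (hM : ((M : ℝ) - 1) * ε < 1) (hN0 : 0 < N) (hM0 : 0 < M) {K : ℕ}
    (hK : 1 ≤ K)     (pol : ℕ → Counters N M → Finset (Fin N)) (hpol : ∀ t c, (pol t c).card = K) (t : ℕ) :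
    μ.real {ω | ¬ IsGood K L ε D (t + 1) (chain ε pol (fun s i => X s i ω) t)}
      ≤ 2 / (t + 1) ^ 2 := by
  set q := trueParam M D ε with hq
  set bias : Fin M → ℝ := fun j => ((K : ℝ) - 1) * (L ^ 4 / ((j : ℕ) + 1) ^ 2) with hbias
  -- Truncation at `0` keeps the centre in `[0, 1]`, as the exponential bound requires.
  set q' : Fin N → Fin M → ℝ := fun i j => max 0 (q i j - bias j) with hq'
  set c : Ω → Counters N M := fun ω => chain ε pol (fun s i => X s i ω) t with hc
  set U : Fin N → Fin M → ℕ → Set Ω := fun i j s => {ω | (c ω).SC i j = s ∧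
      s * bonus N M (t + 1) s ^ 2 ≤ bonus N M (t + 1) s * ((c ω).C i j - q i j * s)} with hU
  set V : Fin N → Fin M → ℕ → Set Ω := fun i j s => {ω | (c ω).SC i j = s ∧
      s * (-bonus N M (t + 1) s) ^ 2
        ≤ (-bonus N M (t + 1) s) * ((c ω).C i j - q' i j * s)} with hV
  have hbias0 : ∀ j, 0 ≤ bias j := fun j => by
    have : (1 : ℝ) ≤ K := by exact_mod_cast hK
    exact mul_nonneg (by linarith) (by positivity)
  have hN1 : (1 : ℝ) ≤ N := by exact_mod_cast hN0
  have hM1 : (1 : ℝ) ≤ M := by exact_mod_cast hM0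
  have hNM1 : (1 : ℝ) ≤ (N : ℝ) * M := one_le_mul_of_one_le_of_one_le hN1 hM1
  have ht1 : (1 : ℝ) ≤ (t : ℝ) + 1 := by linarith [(Nat.cast_nonneg t : (0 : ℝ) ≤ t)]
  have hNMt : 1 ≤ (N : ℝ) * M * ((t + 1 : ℕ) : ℝ) := by
    push_cast
    exact one_le_mul_of_one_le_of_one_le hNM1 ht1
  have hb0 : ∀ s, 0 ≤ bonus N M (t + 1) s := fun s => Real.sqrt_nonneg _
  have hUle : ∀ i j, ∀ s ∈ Finset.Icc 1 t, μ.real (U i j s)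
      ≤ (((N : ℝ) * M * ((t + 1 : ℕ) : ℝ)) ^ 4)⁻¹ := by
    intro i j s hs
    rw [← exp_neg_mul_bonus_sq (s := s) hNMt (by have := (Finset.mem_Icc.1 hs).1; omega)]
    refine h.measureReal_deviation_le hε pol _ (trueParam_nonneg hε i j) (trueParam_le_one i j)
      i j (fun t' c' => ?_) t s
    have := pi_real_winSet_le hD hL hε (pol t' c') i j
    exact mul_nonpos_of_nonneg_of_nonpos (Real.sinh_nonneg_iff.2 (hb0 s)) (by linarith)
  have hVle : ∀ i j, ∀ s ∈ Finset.Icc 1 t, μ.real (V i j s)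
      ≤ (((N : ℝ) * M * ((t + 1 : ℕ) : ℝ)) ^ 4)⁻¹ := by
    intro i j s hs
    rw [← exp_neg_mul_bonus_sq (s := s) hNMt (by have := (Finset.mem_Icc.1 hs).1; omega),
      ← neg_sq (bonus N M (t + 1) s)]
    refine h.measureReal_deviation_le hε pol _ (le_max_left _ _) (max_le zero_le_one ?_)
      i j (fun t' c' => ?_) t s
    · have := trueParam_le_one (M := M) (D := D) (ε := ε) i j
      linarith [hbias0 j]
    · have h1 := le_pi_real_winSet hD hL hε hM (hpol t' c') i j
      have h2 : q' i j * (Measure.pi D).real (obsSet ε (pol t' c') i j)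
          ≤ (Measure.pi D).real (winSet ε (pol t' c') i j) := by
        rcases le_total (q i j - bias j) 0 with h0 | h0
        · simp only [hq', max_eq_left h0, zero_mul]
          exact measureReal_nonneg
        · simp only [hq', max_eq_right h0]
          exact h1
      exact mul_nonpos_of_nonpos_of_nonneg (Real.sinh_nonpos_iff.2 (by linarith [hb0 s]))
        (by linarith)
  have hsub : {ω | ¬ IsGood K L ε D (t + 1) (c ω)}
      ⊆ ⋃ p ∈ (Finset.univ ×ˢ Finset.univ ×ˢ Finset.Icc 1 t : Finset (Fin N × Fin M × ℕ)),
        (U p.1 p.2.1 p.2.2 ∪ V p.1 p.2.1 p.2.2) := by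
    intro ω hω
    simp only [IsGood, Set.mem_ofPred_eq, not_forall] at hω
    obtain ⟨i, j, hs0, hω⟩ := hω
    simp only [Set.mem_iUnion]
    set s := (c ω).SC i j with hs
    have hst : s ≤ t := (chain_le ε pol _ t i j).2
    refine ⟨(i, j, s), by simp; omega, ?_⟩
    have hspos : (0 : ℝ) < s := by exact_mod_cast Nat.pos_of_ne_zero hs0
    by_cases h1 : ((c ω).C i j : ℝ) / s ≤ q i j + bonus N M (t + 1) s
    · right
      have h2 : ¬ q i j ≤ ((c ω).C i j : ℝ) / s + bonus N M (t + 1) s + bias j :=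
        fun h2 => hω ⟨h1, h2⟩
      refine ⟨rfl, ?_⟩
      have h3 : ((c ω).C i j : ℝ) / s + bonus N M (t + 1) s < q' i j :=
        lt_of_lt_of_le (by linarith) (le_max_right _ _)
      rw [← lt_sub_iff_add_lt, div_lt_iff₀ hspos] at h3
      have h4 : s * bonus N M (t + 1) s ≤ q' i j * s - (c ω).C i j := by nlinarith
      nlinarith [mul_le_mul_of_nonneg_left h4 (hb0 s)]
    · left
      refine ⟨rfl, ?_⟩
      rw [not_le, lt_div_iff₀ hspos] at h1
      have h4 : s * bonus N M (t + 1) s ≤ (c ω).C i j - q i j * s := by nlinarith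
      nlinarith [mul_le_mul_of_nonneg_left h4 (hb0 s)]
  refine (measureReal_mono hsub (measure_ne_top _ _)).trans ((measureReal_biUnion_finset_le _ _).trans ?_)
  have hle : ∀ p ∈ (Finset.univ ×ˢ Finset.univ ×ˢ Finset.Icc 1 t : Finset (Fin N × Fin M × ℕ)),
      μ.real (U p.1 p.2.1 p.2.2 ∪ V p.1 p.2.1 p.2.2)
        ≤ 2 * (((N : ℝ) * M * ((t + 1 : ℕ) : ℝ)) ^ 4)⁻¹ := by
    rintro ⟨i, j, s⟩ hp
    have hs : s ∈ Finset.Icc 1 t := by simpa using hp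
    refine (measureReal_union_le _ _).trans ?_
    linarith [hUle i j s hs, hVle i j s hs]
  refine (Finset.sum_le_sum hle).trans ?_
  rw [Finset.sum_const, Finset.card_product, Finset.card_product, Finset.card_univ,
    Finset.card_univ, Fintype.card_fin, Fintype.card_fin, Nat.card_Icc, Nat.add_sub_cancel,
    nsmul_eq_mul]
  push_cast
  set y : ℝ := (N : ℝ) * M with hy
  have hy0 : 0 < y := by linarith
  rw [show (N : ℝ) * (M * t) * (2 * ((y * (t + 1)) ^ 4)⁻¹) = 2 * (y * t) / (y * (t + 1)) ^ 4 by
    rw [hy]; field_simp, div_le_div_iff₀ (by positivity) (by positivity)]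
  have h1 : y * (t : ℝ) ≤ (y * (t + 1)) ^ 2 := by
    have : y * (t : ℝ) ≤ y * (t + 1) := by nlinarith
    have h2 : 1 ≤ y * ((t : ℝ) + 1) := one_le_mul_of_one_le_of_one_le hNM1 ht1
    nlinarith
  have h2 : ((t : ℝ) + 1) ^ 2 ≤ (y * (t + 1)) ^ 2 := by
    have : (t : ℝ) + 1 ≤ y * (t + 1) := by nlinarith
    gcongr
  calc 2 * (y * t) * ((t : ℝ) + 1) ^ 2 ≤ 2 * (y * (t + 1)) ^ 2 * (y * (t + 1)) ^ 2 := by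
        gcongr
    _ = 2 * (y * (t + 1)) ^ 4 := by ring

end Environment

/-! ### Regret of one round -/

/-- Bound on the estimation error of a binary arm with `s` observations, apart from the bias. -/
def width (N M T s : ℕ) : ℝ := if s = 0 then 1 else 2 * bonus N M T s

lemma width_nonneg (N M T s : ℕ) : 0 ≤ width N M T s := by
  unfold width
  split_ifs
  · exact zero_le_one
  · exact mul_nonneg zero_le_two (Real.sqrt_nonneg _)

lemma bonus_mono {N M t T : ℕ} (hN : 0 < N) (hM : 0 < M) (ht : 0 < t) (h : t ≤ T) (s : ℕ) :
    bonus N M t s ≤ bonus N M T s := by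
  unfold bonus
  have hN' : (0 : ℝ) < N := by exact_mod_cast hN
  have hM' : (0 : ℝ) < M := by exact_mod_cast hM
  have ht' : (0 : ℝ) < t := by exact_mod_cast ht
  gcongr

/-- Termwise `j / (j + 1)² ≤ 1 / (j + 2) ≤ log ((j + 2) / (j + 1))`. The bin value `j ε` damps the
large bias of low bins, so the total bias is only of order `ε log M`. -/
lemma sum_div_sq_le_log {ε : ℝ} (hε : 0 ≤ ε) (M : ℕ) :
    ∑ j : Fin M, (j : ℕ) * ε * (1 / ((j : ℕ) + 1) ^ 2) ≤ ε * Real.log (M + 1) := by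
  rw [Fin.sum_univ_eq_sum_range (fun j => (j : ℝ) * ε * (1 / ((j : ℝ) + 1) ^ 2))]
  induction M with
  | zero => simp
  | succ M ih =>
    rw [Finset.sum_range_succ]
    have hM : (0 : ℝ) ≤ M := Nat.cast_nonneg M
    have h1 := Real.one_sub_inv_le_log_of_pos (x := ((M : ℝ) + 1 + 1) / (M + 1)) (by positivity)
    rw [Real.log_div (by positivity) (by positivity), inv_div] at h1
    have h2 : (M : ℝ) * (1 / ((M : ℝ) + 1) ^ 2) ≤ 1 - (M + 1) / ((M : ℝ) + 1 + 1) := by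
      rw [one_sub_div (by positivity), mul_one_div, div_le_div_iff₀ (by positivity) (by positivity)]
      nlinarith
    push_cast
    nlinarith [mul_le_mul_of_nonneg_left (h2.trans h1) hε]

section Round

variable {N M : ℕ} {D : Fin N → Measure ℝ} [∀ i, IsProbabilityMeasure (D i)] {ε L : ℝ} {K : ℕ}

omit [∀ i, IsProbabilityMeasure (D i)] in
lemma trueParam_le_ucb {t : ℕ} {c : Counters N M} (hc : IsGood K L ε D t c) (i : Fin N)
    (j : Fin M) : trueParam M D ε i j ≤ ucb K L t c i j := by
  have h1 := trueParam_le_one (M := M) (D := D) (ε := ε) i j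
  unfold ucb
  split_ifs with h
  · exact h1
  · exact le_min (hc i j h).2 h1

lemma ucb_sub_trueParam_le (hK : 1 ≤ K) (hε : 0 < ε) (hN : 0 < N) (hM : 0 < M) {t T : ℕ}
    (ht : 0 < t) (htT : t ≤ T) {c : Counters N M} (hc : IsGood K L ε D t c) (i : Fin N)
    (j : Fin M) :
    ucb K L t c i j - trueParam M D ε i j
      ≤ width N M T (c.SC i j) + ((K : ℝ) - 1) * (L ^ 4 / ((j : ℕ) + 1) ^ 2) := by
  have h0 := trueParam_nonneg (M := M) (D := D) hε i j
  have hK' : (0 : ℝ) ≤ (K : ℝ) - 1 := by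
    have : (1 : ℝ) ≤ K := by exact_mod_cast hK
    linarith
  have hb : 0 ≤ ((K : ℝ) - 1) * (L ^ 4 / (((j : ℕ) : ℝ) + 1) ^ 2) :=
    mul_nonneg hK' (by positivity)
  unfold ucb width
  split_ifs with h
  · linarith
  · have h1 := (hc i j h).1
    have h2 := bonus_mono hN hM ht htT (c.SC i j)
    have h3 := min_le_left ((c.C i j : ℝ) / c.SC i j + bonus N M t (c.SC i j)
      + ((K : ℝ) - 1) * (L ^ 4 / ((j : ℝ) + 1) ^ 2)) 1
    linarith

lemma exists_expReward_eq_optReward (D : Fin N → Measure ℝ) (hKN : K ≤ N) :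
    ∃ S : Finset (Fin N), S.card = K ∧ expReward D S = optReward D K := by
  obtain ⟨S, -, hS⟩ := Finset.exists_subset_card_eq (s := (Finset.univ : Finset (Fin N)))
    (by simpa using hKN)
  have : Nonempty {S : Finset (Fin N) // S.card = K} := ⟨⟨S, hS⟩⟩
  obtain ⟨S', h⟩ := exists_eq_ciSup_of_finite
    (f := fun S : {S : Finset (Fin N) // S.card = K} => expReward D S)
  exact ⟨S', S'.2, h⟩

lemma optReward_sub_expReward_mem_Icc (hD : ∀ i, BiLipschitzOutcome L (D i)) (hK : 0 < K)
    (hKN : K ≤ N) {S : Finset (Fin N)} (hS : S.card = K) :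
    optReward D K - expReward D S ∈ Set.Icc (0 : ℝ) 1 := by
  obtain ⟨S', hS', e⟩ := exists_expReward_eq_optReward D hKN
  have h1 := expReward_mem_Icc hD (Finset.card_pos.1 (hS ▸ hK))
  have h2 := expReward_mem_Icc hD (Finset.card_pos.1 (hS' ▸ hK))
  rw [e] at h2
  refine ⟨sub_nonneg.2 ?_, by linarith [h1.1, h2.2]⟩
  exact le_ciSup (f := fun S : {S : Finset (Fin N) // S.card = K} => expReward D S)
    (Set.finite_range _).bddAbove ⟨S, hS⟩

/-- The usual optimism argument. One `ε` comes from discretizing the optimal action and one from the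
oracle; discretizing the played action errs in the favourable direction. -/
lemma regret_le_of_isGood (hD : ∀ i, BiLipschitzOutcome L (D i)) (hL : 1 ≤ L) (hε : 0 < ε)
    (hε1 : ε ≤ 1) (hM1 : 1 ≤ M * ε) (hM2 : ((M : ℝ) - 1) * ε < 1) (hM : 0 < M) (hK : 1 < K)
    (hKN : K ≤ N) {oracle : (Fin N → Fin M → ℝ) → Finset (Fin N)}
    (ho : IsApproxOracle ε (1 - ε) K oracle) {t T : ℕ} (ht : 0 < t) (htT : t ≤ T)
    {c : Counters N M} (hc : IsGood K L ε D t c) :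
    optReward D K - expReward D (policy K L oracle t c)
      ≤ 2 * ε + (K : ℝ) ^ 2 * L ^ 4 * (ε * Real.log (M + 1))
        + ∑ i, ∑ j : Fin M, (Measure.pi D).real (obsSet ε (policy K L oracle t c) i j)
          * width N M T (c.SC i j) := by
  set q := trueParam M D ε with hq
  set q' := ucb K L t c with hq'
  set S := policy K L oracle t c with hS
  have hScard : S.card = K := card_policy hK hL hM ho t c
  have hSne : S.Nonempty := Finset.card_pos.1 (by omega)
  obtain ⟨S', hS', e⟩ := exists_expReward_eq_optReward D hKN
  have hS'ne : S'.Nonempty := Finset.card_pos.1 (by omega)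
  have h0 : ∀ i j, 0 ≤ q i j := trueParam_nonneg hε
  have hqq : ∀ i j, q i j ≤ q' i j := trueParam_le_ucb hc
  have h1 : ∀ i j, q' i j ≤ 1 := ucb_le_one t c
  have hz := trueParam_zero (M := M) hD hL hε
  have hb' := discReward_trueParam_bounds hD hL hε hM1 hM hS'ne
  have hb := discReward_trueParam_bounds hD hL hε hM1 hM hSne
  have horacle := (ho _ (isProbSet_ucb hK hL hM t c)).2 S' hS'
  have hmono := discReward_binaryToDisc_mono hε.le h0 hqq h1 hz hM S'
  have hsmooth := discReward_binaryToDisc_le hε.le h0 hqq h1 hz hM S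
  have hS'1 := (expReward_mem_Icc hD hS'ne).2
  have hopt : optReward D K ≤ discReward ε (binaryToDisc q') S + 2 * ε := by
    rw [← e]
    change (1 - ε) * discReward ε (binaryToDisc q') S' ≤ discReward ε (binaryToDisc q') S
      at horacle
    -- The oracle's multiplicative loss is charged to the true discrete reward of `S'`, which is at
    -- most `1`.
    nlinarith [mul_le_mul_of_nonneg_left hmono (sub_nonneg.2 hε1),
      mul_le_mul_of_nonneg_left (hb'.1.trans hS'1) hε.le]
  have hK' : (1 : ℝ) ≤ K := by exact_mod_cast hK.le
  have hterm : ∀ j : Fin M, ((j : ℕ) : ℝ) * ε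
        * (survival q S (j + 1) * ∑ i ∈ S, (q' i j - q i j))
      ≤ (K : ℝ) ^ 2 * L ^ 4 * ((j : ℕ) * ε * (1 / ((j : ℕ) + 1) ^ 2))
        + ∑ i, (Measure.pi D).real (obsSet ε S i j) * width N M T (c.SC i j) := by
    intro j
    have hj : ((j : ℕ) : ℝ) ≤ M - 1 := by
      have := j.2
      have : ((j : ℕ) : ℝ) + 1 ≤ M := by exact_mod_cast this
      linarith
    have hj1 : ((j : ℕ) : ℝ) * ε ≤ 1 := le_trans (by gcongr) hM2.le
    have hj0 : 0 ≤ ((j : ℕ) : ℝ) * ε := by positivity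
    have hsv0 : 0 ≤ survival q S (j + 1) := survival_nonneg trueParam_le_one S _
    have hsv1 : survival q S (j + 1) ≤ 1 := survival_le_one h0 trueParam_le_one S _
    have hobs : ∑ i, (Measure.pi D).real (obsSet ε S i j) * width N M T (c.SC i j)
        = ∑ i ∈ S, survival q S (j + 1) * width N M T (c.SC i j) := by
      rw [← Finset.sum_subset (Finset.subset_univ S)]
      · refine Finset.sum_congr rfl fun i hi => ?_
        rw [pi_real_obsSet hD hi, survival_trueParam hD hL hε hM1 S j.2]
      · intro i _ hi
        rw [obsSet_eq_empty hi, measureReal_empty, zero_mul]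
    rw [hobs]
    have hbias0 : 0 ≤ ((K : ℝ) - 1) * (L ^ 4 / (((j : ℕ) : ℝ) + 1) ^ 2) :=
      mul_nonneg (by linarith) (by positivity)
    have hsum : ∑ i ∈ S, (q' i j - q i j) ≤ ∑ i ∈ S, width N M T (c.SC i j)
        + K * (((K : ℝ) - 1) * (L ^ 4 / ((j : ℕ) + 1) ^ 2)) := by
      refine (Finset.sum_le_sum fun i _ =>
        ucb_sub_trueParam_le hK.le hε (by omega) hM ht htT hc i j).trans_eq ?_
      rw [Finset.sum_add_distrib, Finset.sum_const, hScard, nsmul_eq_mul]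
    have hW : 0 ≤ ∑ i ∈ S, width N M T (c.SC i j) :=
      Finset.sum_nonneg fun i _ => width_nonneg _ _ _ _
    rw [← Finset.mul_sum]
    set v := ((j : ℕ) : ℝ) * ε
    set s := survival q S (j + 1)
    set W := ∑ i ∈ S, width N M T (c.SC i j)
    set b := ((K : ℝ) - 1) * (L ^ 4 / (((j : ℕ) : ℝ) + 1) ^ 2) with hbdef
    have hKb : K * b ≤ (K : ℝ) ^ 2 * L ^ 4 * (1 / (((j : ℕ) : ℝ) + 1) ^ 2) := by
      rw [hbdef, div_eq_mul_one_div (L ^ 4)]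
      have : 0 ≤ L ^ 4 * (1 / (((j : ℕ) : ℝ) + 1) ^ 2) := by positivity
      nlinarith
    calc v * (s * ∑ i ∈ S, (q' i j - q i j)) ≤ v * (s * (W + K * b)) := by gcongr
      _ = v * (s * W) + v * (s * (K * b)) := by ring
      _ ≤ 1 * (s * W) + v * (1 * (K * b)) := by gcongr
      _ ≤ (K : ℝ) ^ 2 * L ^ 4 * (v * (1 / (((j : ℕ) : ℝ) + 1) ^ 2)) + s * W := by
        nlinarith [mul_le_mul_of_nonneg_left hKb hj0]
  have hsumterm := Finset.sum_le_sum fun j (_ : j ∈ (Finset.univ : Finset (Fin M))) => hterm j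
  rw [Finset.sum_add_distrib, ← Finset.mul_sum, Finset.sum_comm] at hsumterm
  have hlog := mul_le_mul_of_nonneg_left (sum_div_sq_le_log hε.le M)
    (show 0 ≤ (K : ℝ) ^ 2 * L ^ 4 by positivity)
  linarith [hb.1]

end Round

/-! ### The potential of the counters -/

/-- Total width of the observations made so far. -/
def potential {N M : ℕ} (T : ℕ) (c : Counters N M) : ℝ :=
  ∑ i, ∑ j, ∑ s ∈ Finset.range (c.SC i j), width N M T s

/-- Each observation adds exactly the current width of the observed binary arm. -/
lemma potential_stepCounters {N M : ℕ} (T : ℕ) (ε : ℝ) (c : Counters N M) (S : Finset (Fin N))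
    (x : Fin N → ℝ) :
    potential T (stepCounters ε c S x) = potential T c
      + ∑ i, ∑ j : Fin M, (obsSet ε S i j).indicator (fun _ => (1 : ℝ)) x
        * width N M T (c.SC i j) := by
  simp only [potential, ← Finset.sum_add_distrib]
  refine Finset.sum_congr rfl fun i _ => Finset.sum_congr rfl fun j _ => ?_
  unfold stepCounters
  by_cases h : x ∈ obsSet ε S i j
  · simp only [h, if_true, Finset.sum_range_succ, Set.indicator_of_mem, one_mul]
  · simp [h]

/-- The unobserved state `s = 0` costs `1`; the others follow the pattern `∑ 1 / √s ≤ 2 √n`. -/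
lemma sum_width_le {N M T : ℕ} (hNMT : 1 ≤ (N : ℝ) * M * T) (n : ℕ) :
    ∑ s ∈ Finset.range n, width N M T s
      ≤ 1 + 4 * √(8 * Real.log ((N : ℝ) * M * T)) * √n := by
  set A := √(8 * Real.log ((N : ℝ) * M * T)) with hA
  have hA0 : 0 ≤ A := Real.sqrt_nonneg _
  have key : ∀ n : ℕ, ∑ s ∈ Finset.range (n + 1), width N M T s ≤ 1 + 4 * A * √n := by
    intro n
    induction n with
    | zero => simp [width]
    | succ n ih =>
      rw [Finset.sum_range_succ]
      have hw : width N M T (n + 1) = 2 * A / √((n : ℝ) + 1) := by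
        rw [width, if_neg (by omega), bonus, Real.sqrt_div
          (mul_nonneg (by norm_num) (Real.log_nonneg hNMT)), mul_div_assoc]
        push_cast
        rfl
      rw [hw]
      push_cast
      set b := √((n : ℝ) + 1) with hb
      set a := √(n : ℝ) with ha
      have hb0 : 0 < b := Real.sqrt_pos.2 (by positivity)
      have ha0 : 0 ≤ a := Real.sqrt_nonneg _
      have hb2 : b ^ 2 = n + 1 := Real.sq_sqrt (by positivity)
      have ha2 : a ^ 2 = n := Real.sq_sqrt (by positivity)
      have hinv : 1 / b ≤ 2 * (b - a) := by
        rw [div_le_iff₀ hb0]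
        nlinarith [sq_nonneg (b - a)]
      have : 2 * A / b ≤ 4 * A * (b - a) := by
        rw [div_eq_mul_one_div]
        nlinarith
      linarith
  rcases n with _ | n
  · simp
  · refine (key n).trans ?_
    gcongr
    omega

lemma sum_SC_chain_le {N M K : ℕ} (ε : ℝ) (pol : ℕ → Counters N M → Finset (Fin N))
    (hpol : ∀ t c, (pol t c).card = K) (x : ℕ → Fin N → ℝ) (t : ℕ) :
    ∑ i, ∑ j, ((chain ε pol x t).SC i j : ℝ) ≤ K * M * t := by
  classical
  induction t with
  | zero => simp [chain]
  | succ t ih =>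
    set c := chain ε pol x t with hc
    set S := pol (t + 1) c with hS
    have h1 : ∀ i (j : Fin M), ((chain ε pol x (t + 1)).SC i j : ℝ)
        ≤ c.SC i j + if i ∈ S then 1 else 0 := by
      intro i j
      rw [chain]
      by_cases hi : i ∈ S
      · simp only [stepCounters, hi, if_true]
        push_cast
        gcongr
        split_ifs <;> simp
      · simp [stepCounters, ← hS, ← hc, obsSet_eq_empty hi, hi]
    have h2 : ∑ i, ∑ j : Fin M, ((c.SC i j : ℝ) + if i ∈ S then 1 else 0)
        = ∑ i, ∑ j, (c.SC i j : ℝ) + K * M := by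
      simp_rw [Finset.sum_add_distrib, Finset.sum_const, Finset.card_univ, Fintype.card_fin]
      congr 1
      rw [← Finset.smul_sum, Finset.sum_ite_mem, Finset.univ_inter, Finset.sum_const, hpol,
        nsmul_eq_mul, nsmul_eq_mul, mul_one, mul_comm]
    have h3 := Finset.sum_le_sum fun i (_ : i ∈ (Finset.univ : Finset (Fin N))) =>
      Finset.sum_le_sum fun j (_ : j ∈ (Finset.univ : Finset (Fin M))) => h1 i j
    rw [h2] at h3
    push_cast
    linarith

/-- Cauchy–Schwarz over the `N M` counters, whose sum is at most `K M T` since a round advances at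
most `K M` of them. The constant is `4 √8 ≤ 12`. -/
lemma potential_chain_le {N M K T : ℕ} (hNMT : 1 ≤ (N : ℝ) * M * T) (ε : ℝ)
    (pol : ℕ → Counters N M → Finset (Fin N)) (hpol : ∀ t c, (pol t c).card = K)
    (x : ℕ → Fin N → ℝ) :
    potential T (chain ε pol x T)
      ≤ N * M + 12 * √(N * K * M ^ 2 * T * Real.log ((N : ℝ) * M * T)) := by
  set c := chain ε pol x T with hc
  set A := √(8 * Real.log ((N : ℝ) * M * T)) with hA
  have hlog := Real.log_nonneg hNMT
  have h1 : potential T c ≤ ∑ p : Fin N × Fin M, (1 + 4 * A * √(c.SC p.1 p.2)) := by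
    rw [Fintype.sum_prod_type]
    exact Finset.sum_le_sum fun i _ => Finset.sum_le_sum fun j _ => sum_width_le hNMT _
  rw [Finset.sum_add_distrib, ← Finset.mul_sum, Finset.sum_const, Finset.card_univ,
    Fintype.card_prod, Fintype.card_fin, Fintype.card_fin, nsmul_eq_mul, mul_one] at h1
  have h2 : ∑ p : Fin N × Fin M, √(c.SC p.1 p.2 : ℝ) ≤ √(N * M * (K * M * T)) := by
    refine Real.le_sqrt_of_sq_le (sq_sum_le_card_mul_sum_sq.trans ?_)
    rw [Finset.card_univ, Fintype.card_prod, Fintype.card_fin, Fintype.card_fin]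
    simp_rw [Real.sq_sqrt (Nat.cast_nonneg _)]
    rw [Fintype.sum_prod_type]
    push_cast
    gcongr
    exact sum_SC_chain_le ε pol hpol x T
  refine h1.trans ?_
  push_cast
  have hA0 : 0 ≤ A := Real.sqrt_nonneg _
  have h3 : 4 * A * √((N : ℝ) * M * (K * M * T))
      ≤ 12 * √(N * K * M ^ 2 * T * Real.log ((N : ℝ) * M * T)) := by
    rw [mul_assoc, hA, ← Real.sqrt_mul (by positivity)]
    have : 8 * Real.log ((N : ℝ) * M * T) * ((N : ℝ) * M * (K * M * T))
        ≤ 3 ^ 2 * (N * K * M ^ 2 * T * Real.log ((N : ℝ) * M * T)) := by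
      have : 0 ≤ N * K * M ^ 2 * T * Real.log ((N : ℝ) * M * T) := by positivity
      nlinarith
    have h4 := Real.sqrt_le_sqrt this
    rw [Real.sqrt_mul (x := 3 ^ 2) (by norm_num), Real.sqrt_sq (by norm_num)] at h4
    linarith
  linarith [mul_le_mul_of_nonneg_left h2 (mul_nonneg (by norm_num : (0 : ℝ) ≤ 4) hA0)]

/-! ### The expected regret -/

lemma sum_two_div_sq_le (n : ℕ) : ∑ t ∈ Finset.range n, (2 : ℝ) / ((t : ℝ) + 1) ^ 2 ≤ 4 := by
  have key : ∀ n : ℕ, ∑ t ∈ Finset.range (n + 1), (2 : ℝ) / ((t : ℝ) + 1) ^ 2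
      ≤ 4 - 2 / ((n : ℝ) + 1) := by
    intro n
    induction n with
    | zero => norm_num
    | succ n ih =>
      rw [Finset.sum_range_succ]
      have : (2 : ℝ) / (((n + 1 : ℕ) : ℝ) + 1) ^ 2
          ≤ 2 / ((n : ℝ) + 1) - 2 / (((n + 1 : ℕ) : ℝ) + 1) := by
        push_cast
        rw [div_sub_div _ _ (by positivity) (by positivity),
          div_le_div_iff₀ (by positivity) (by positivity)]
        have : (0 : ℝ) ≤ n := Nat.cast_nonneg n
        nlinarith [mul_nonneg this this, mul_nonneg this (mul_nonneg this this)]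
      linarith
  rcases n with _ | n
  · norm_num
  · refine (key n).trans ?_
    have : (0 : ℝ) ≤ 2 / ((n : ℝ) + 1) := by positivity
    linarith

section Environment

variable {N M : ℕ} {Ω : Type*} [MeasurableSpace Ω] {μ : Measure Ω} [IsProbabilityMeasure μ]
  {D : Fin N → Measure ℝ} [∀ i, IsProbabilityMeasure (D i)] {X : ℕ → Fin N → Ω → ℝ}
  {win : ℕ → Finset (Fin N) → Ω → Fin N} {ε L : ℝ}

/-- Given the counters, the weights are the exact probabilities with which the potential gains these
widths, so the sum over rounds telescopes. -/
lemma IsEnvironment.integral_width_eq (h : IsEnvironment μ D X win)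
    (pol : ℕ → Counters N M → Finset (Fin N)) (T t : ℕ) :
    ∫ ω, ∑ i, ∑ j : Fin M, (Measure.pi D).real
        (obsSet ε (pol (t + 1) (chain ε pol (fun s i => X s i ω) t)) i j)
        * width N M T ((chain ε pol (fun s i => X s i ω) t).SC i j) ∂μ
      = ∫ ω, potential T (chain ε pol (fun s i => X s i ω) (t + 1)) ∂μ
        - ∫ ω, potential T (chain ε pol (fun s i => X s i ω) t) ∂μ := by
  have hstep : ∀ c : Counters N M,
      ∫ x, potential T (stepCounters ε c (pol (t + 1) c) x) ∂(Measure.pi D)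
      = potential T c + ∑ i, ∑ j : Fin M, (Measure.pi D).real (obsSet ε (pol (t + 1) c) i j)
        * width N M T (c.SC i j) := by
    intro c
    simp_rw [potential_stepCounters]
    have hI : ∀ i (j : Fin M), Integrable (fun x => (obsSet ε (pol (t + 1) c) i j).indicator
        (fun _ => (1 : ℝ)) x * width N M T (c.SC i j)) (Measure.pi D) := fun i j =>
      ((integrable_indicator_iff (measurableSet_obsSet ε _ i j)).2
        (integrable_const (1 : ℝ)).integrableOn).mul_const _
    rw [integral_add (integrable_const _)
      (integrable_finsetSum _ fun i _ => integrable_finsetSum _ fun j _ => hI i j),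
      integral_const, probReal_univ, one_smul,
      integral_finsetSum _ fun i _ => integrable_finsetSum _ fun j _ => hI i j]
    congr 1
    refine Finset.sum_congr rfl fun i _ => ?_
    rw [integral_finsetSum _ fun j _ => hI i j]
    refine Finset.sum_congr rfl fun j _ => ?_
    rw [integral_mul_const, integral_indicator_const _ (measurableSet_obsSet ε _ i j),
      smul_eq_mul, mul_one]
  rw [h.integral_chain_succ]
  simp_rw [hstep]
  rw [integral_add (h.integrable_comp_chain pol t (potential T))
    (h.integrable_comp_chain pol t fun c => ∑ i, ∑ j : Fin M, (Measure.pi D).real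
      (obsSet ε (pol (t + 1) c) i j) * width N M T (c.SC i j)), add_sub_cancel_left]

lemma IsEnvironment.integral_regret_le (h : IsEnvironment μ D X win)
    (hD : ∀ i, BiLipschitzOutcome L (D i)) (hL : 1 ≤ L) (hε : 0 < ε)
    (hε1 : ε ≤ 1) (hM1 : 1 ≤ M * ε) (hM2 : ((M : ℝ) - 1) * ε < 1) (hM : 0 < M) {K T : ℕ}
    (hK : 1 < K) (hKN : K ≤ N) (hT : 0 < T) {oracle : (Fin N → Fin M → ℝ) → Finset (Fin N)}
    (ho : IsApproxOracle ε (1 - ε) K oracle) :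
    ∫ ω, ∑ t ∈ Finset.range T, (optReward D K - expReward D (policy K L oracle (t + 1)
        (chain ε (policy K L oracle) (fun s i => X s i ω) t))) ∂μ
      ≤ 12 * √(N * K * M ^ 2 * T * Real.log ((N : ℝ) * M * T))
        + T * ε * ((K : ℝ) ^ 2 * L ^ 4 * Real.log (M + 1) + 2) + N * M + 4 := by
  set pol := policy K L oracle with hpol
  have hcard : ∀ t c, (pol t c).card = K := card_policy hK hL hM ho
  set c : ℕ → Ω → Counters N M := fun t ω => chain ε pol (fun s i => X s i ω) t with hc
  set bad : ℕ → Set (Counters N M) := fun t => {c | ¬ IsGood K L ε D (t + 1) c} with hbad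
  set G : ℕ → Counters N M → ℝ := fun t c => ∑ i, ∑ j : Fin M,
    (Measure.pi D).real (obsSet ε (pol (t + 1) c) i j) * width N M T (c.SC i j) with hG
  set κ : ℝ := 2 * ε + (K : ℝ) ^ 2 * L ^ 4 * (ε * Real.log (M + 1)) with hκ
  have hI : ∀ t (Φ : Counters N M → ℝ), Integrable (fun ω => Φ (c t ω)) μ := fun t Φ =>
    h.integrable_comp_chain pol t Φ
  have hκ0 : 0 ≤ κ := by
    have : 0 ≤ Real.log ((M : ℝ) + 1) := Real.log_nonneg (by
      linarith [(Nat.cast_nonneg M : (0 : ℝ) ≤ M)])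
    positivity
  have hG0 : ∀ t c, 0 ≤ G t c := fun t c => Finset.sum_nonneg fun i _ =>
    Finset.sum_nonneg fun j _ => mul_nonneg measureReal_nonneg (width_nonneg _ _ _ _)
  have hround : ∀ t ∈ Finset.range T,
      ∫ ω, (optReward D K - expReward D (pol (t + 1) (c t ω))) ∂μ
      ≤ 2 / ((t : ℝ) + 1) ^ 2 + κ + (∫ ω, potential T (c (t + 1) ω) ∂μ
        - ∫ ω, potential T (c t ω) ∂μ) := by
    intro t ht
    have hpt : ∀ c' : Counters N M, optReward D K - expReward D (pol (t + 1) c')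
        ≤ (bad t).indicator (fun _ => (1 : ℝ)) c' + κ + G t c' := by
      intro c'
      by_cases hg : IsGood K L ε D (t + 1) c'
      · have h1 : c' ∉ bad t := fun h => h hg
        rw [Set.indicator_of_notMem h1, zero_add]
        exact regret_le_of_isGood hD hL hε hε1 hM1 hM2 hM hK hKN ho (Nat.succ_pos t)
          (Finset.mem_range.1 ht) hg
      · have h1 : c' ∈ bad t := hg
        rw [Set.indicator_of_mem h1]
        have := (optReward_sub_expReward_mem_Icc hD (by omega) hKN (hcard (t + 1) c')).2
        linarith [hG0 t c']
    refine (integral_mono (hI t fun c' => optReward D K - expReward D (pol (t + 1) c'))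
      (hI t fun c' => (bad t).indicator (fun _ => (1 : ℝ)) c' + κ + G t c')
      fun ω => hpt (c t ω)).trans ?_
    rw [integral_add (hI t fun c' => (bad t).indicator (fun _ => (1 : ℝ)) c' + κ) (hI t (G t)),
      integral_add (hI t fun c' => (bad t).indicator (fun _ => (1 : ℝ)) c')
      (integrable_const _), integral_const, probReal_univ, one_smul,
      h.integral_width_eq pol T t]
    gcongr
    have hmeas : MeasurableSet (c t ⁻¹' bad t) :=
      h.measurable_chain pol t (MeasurableSet.of_discrete)
    have : ∫ ω, (bad t).indicator (fun _ => (1 : ℝ)) (c t ω) ∂μ = μ.real (c t ⁻¹' bad t) := by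
      have h2 : (fun ω => (bad t).indicator (fun _ => (1 : ℝ)) (c t ω))
          = (c t ⁻¹' bad t).indicator fun _ => (1 : ℝ) := rfl
      rw [h2, integral_indicator_const _ hmeas, smul_eq_mul, mul_one]
    rw [this]
    exact h.measureReal_not_isGood_le hD hL hε hM2 (by omega) hM hK.le pol hcard t
  rw [integral_finsetSum _ fun t _ =>
    hI t fun c' => optReward D K - expReward D (pol (t + 1) c')]
  refine (Finset.sum_le_sum hround).trans ?_
  rw [Finset.sum_add_distrib, Finset.sum_add_distrib, Finset.sum_const, Finset.card_range,
    Finset.sum_range_sub fun t => ∫ ω, potential T (c t ω) ∂μ, nsmul_eq_mul]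
  have h0 : ∫ ω, potential T (c 0 ω) ∂μ = 0 := by simp [hc, chain, potential]
  have hNMT : 1 ≤ (N : ℝ) * M * T := by
    have : 0 < N * M * T := Nat.mul_pos (Nat.mul_pos (by omega) hM) hT
    exact_mod_cast this
  have hpot : ∫ ω, potential T (c T ω) ∂μ
      ≤ N * M + 12 * √(N * K * M ^ 2 * T * Real.log ((N : ℝ) * M * T)) := by
    refine (integral_mono (hI T (potential T)) (integrable_const _) fun ω =>
      potential_chain_le hNMT ε pol hcard _).trans_eq ?_
    rw [integral_const, probReal_univ, one_smul]
  have := sum_two_div_sq_le T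
  rw [h0, hκ]
  linarith

lemma IsEnvironment.pathRegret_ae_eq (h : IsEnvironment μ D X win)
    (hD : ∀ i, BiLipschitzOutcome L (D i)) (hL : 1 ≤ L) (hε : 0 < ε) {K : ℕ} (T : ℕ) (hK : 1 < K)
    (hM : 0 < numBins ε) {oracle : (Fin N → Fin (numBins ε) → ℝ) → Finset (Fin N)} {α : ℝ}
    (ho : IsApproxOracle ε α K oracle) :
    (fun ω => pathRegret D K L ε oracle T (fun t i => X t i ω) (fun t S => win t S ω)) =ᵐ[μ]
      fun ω => ∑ t ∈ Finset.range T, (optReward D K - expReward D (policy K L oracle (t + 1)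
        (chain ε (policy K L oracle) (fun s i => X s i ω) t))) := by
  filter_upwards [h.ae_injective hD] with ω hω
  refine Finset.sum_congr rfl fun t _ => ?_
  rw [action, countersAfter_eq_chain hε (fun t c => Finset.card_pos.1
    (by rw [card_policy hK hL hM ho]; omega)) hω (fun t S hS => h.win_mem t S ω hS)
    (fun t S k hk => h.win_max t S ω k hk)]

lemma IsEnvironment.pathRegret_bounds (h : IsEnvironment μ D X win)
    (hD : ∀ i, BiLipschitzOutcome L (D i)) (hL : 1 ≤ L) (hε : 0 < ε)
    (hε1 : ε ≤ 1) {K T : ℕ} (hK : 1 < K) (hKN : K ≤ N) (hT : 0 < T)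
    {oracle : (Fin N → Fin (numBins ε) → ℝ) → Finset (Fin N)}
    (ho : IsApproxOracle ε (1 - ε) K oracle) :
    let R := fun ω => pathRegret D K L ε oracle T (fun t i => X t i ω) (fun t S => win t S ω)
    let M : ℝ := numBins ε
    Integrable R μ ∧ ∫ ω, R ω ∂μ ≤ T ∧
      ∫ ω, R ω ∂μ ≤ 12 * √(N * K * M ^ 2 * T * Real.log ((N : ℝ) * M * T))
        + T * ε * ((K : ℝ) ^ 2 * L ^ 4 * Real.log (M + 1) + 2) + N * M + 4 := by
  intro R M
  have hM : 0 < numBins ε := Nat.ceil_pos.2 (by positivity)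
  have hM1 : 1 ≤ (numBins ε : ℝ) * ε := by
    rw [← div_le_iff₀ hε]
    exact Nat.le_ceil _
  have hM2 : ((numBins ε : ℝ) - 1) * ε < 1 := by
    rw [← lt_div_iff₀ hε, sub_lt_iff_lt_add]
    exact Nat.ceil_lt_add_one (by positivity)
  have hae := h.pathRegret_ae_eq hD hL hε T hK hM ho
  have hint : ∀ t, Integrable (fun ω => optReward D K - expReward D (policy K L oracle (t + 1)
        (chain ε (policy K L oracle) (fun s i => X s i ω) t))) μ := fun t =>
    h.integrable_comp_chain _ t fun c => optReward D K - expReward D (policy K L oracle (t + 1) c)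
  have hint' := integrable_finsetSum (Finset.range T) fun t _ => hint t
  refine ⟨hint'.congr hae.symm, ?_, ?_⟩
  · rw [integral_congr_ae hae, integral_finsetSum _ fun t _ => hint t]
    have hle : ∀ t ∈ Finset.range T, ∫ ω, (optReward D K - expReward D (policy K L oracle (t + 1)
        (chain ε (policy K L oracle) (fun s i => X s i ω) t))) ∂μ ≤ 1 := by
      intro t _
      refine (integral_mono (hint t) (integrable_const 1) fun ω =>
        (optReward_sub_expReward_mem_Icc hD (by omega) hKN (card_policy hK hL hM ho _ _)).2).trans_eq
        ?_
      simp
    refine (Finset.sum_le_sum hle).trans_eq ?_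
    simp
  · rw [integral_congr_ae hae]
    exact h.integral_regret_le hD hL hε hε1 hM1 hM2 hM hK hKN hT ho

end Environment

/-! ### The form of the bounds -/

/-- The logarithmic term of the explicit bound can be negative for large `N`; it is never so
negative that `16 N M` cannot absorb it. -/
lemma logb_sqrt_ge {N y : ℝ} (hN : 1 ≤ N) (hy : 1 ≤ y) : -N ≤ Real.logb 2 (√(y / N)) + 5 := by
  have hlog2 := Real.log_two_gt_d9
  have h1 : 1 / N ≤ y / N := by gcongr
  have h2 : -N ≤ Real.log (y / N) := by
    have h3 := Real.log_le_log (by positivity) h1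
    rw [one_div, Real.log_inv] at h3
    have := Real.log_le_sub_one_of_pos (show 0 < N by linarith)
    linarith
  rw [Real.logb, Real.log_sqrt (by positivity)]
  have h4 : -N ≤ Real.log (y / N) / 2 / Real.log 2 := by
    rw [div_div, le_div_iff₀ (by positivity)]
    nlinarith
  linarith

lemma explicit_bound {N M K T ε L R : ℝ} (hN : 3 ≤ N) (hM : 3 ≤ M) (hK : 1 ≤ K) (hT : 1 ≤ T)
    (hε : 0 < ε) (hlog : 1 ≤ Real.log (N * M * T))
    (hR : R ≤ 12 * √(N * K * M ^ 2 * T * Real.log (N * M * T))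
      + T * ε * (K ^ 2 * L ^ 4 * Real.log (M + 1) + 2) + N * M + 4) :
    R ≤ 12289 * √(N * K * M ^ 2 * T * Real.log (N * M * T))
      + T * ε * (4 * K ^ 2 * L ^ 4 * Real.log (M + 1) + 3) + 16 * N * M
      + Real.pi ^ 2 * (Real.logb 2 (√(K * M ^ 2 * T * Real.log (N * M * T) / N)) + 5) / 6
      + T⁻¹ := by
  have hs := Real.sqrt_nonneg (N * K * M ^ 2 * T * Real.log (N * M * T))
  have hlogM : 0 ≤ Real.log (M + 1) := Real.log_nonneg (by linarith)
  have h1 : T * ε * (K ^ 2 * L ^ 4 * Real.log (M + 1) + 2)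
      ≤ T * ε * (4 * K ^ 2 * L ^ 4 * Real.log (M + 1) + 3) := by
    have : 0 ≤ K ^ 2 * L ^ 4 * Real.log (M + 1) := by positivity
    gcongr ?_ * ?_
    linarith
  have hy : 1 ≤ K * M ^ 2 * T * Real.log (N * M * T) :=
    one_le_mul_of_one_le_of_one_le (one_le_mul_of_one_le_of_one_le
      (one_le_mul_of_one_le_of_one_le hK (one_le_pow₀ (by linarith))) hT) hlog
  have h2 := logb_sqrt_ge (show 1 ≤ N by linarith) hy
  have hpi2 : Real.pi ^ 2 ≤ 12 := by nlinarith [Real.pi_gt_three, Real.pi_lt_d2]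
  have h3 : -(2 * N) ≤ Real.pi ^ 2
      * (Real.logb 2 (√(K * M ^ 2 * T * Real.log (N * M * T) / N)) + 5) / 6 := by
    nlinarith [mul_le_mul_of_nonneg_left h2 (sq_nonneg Real.pi)]
  have hT0 : 0 ≤ T⁻¹ := by positivity
  nlinarith

/-- The term `N M` is dominated by the square root when `N ≤ K T`. Otherwise `T ≤ N`, and the
trivial bound `R ≤ T` suffices. -/
lemma order_bound {N M K T ε L R : ℝ} (hN : 3 ≤ N) (hM : 3 ≤ M) (hK : 1 ≤ K) (hT : 1 ≤ T)
    (hε : 0 < ε) (hL : 1 ≤ L) (hlog : 1 ≤ Real.log (N * M * T)) (hRT : R ≤ T)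
    (hR : R ≤ 12 * √(N * K * M ^ 2 * T * Real.log (N * M * T))
      + T * ε * (K ^ 2 * L ^ 4 * Real.log (M + 1) + 2) + N * M + 4) :
    R ≤ 17 * Real.log (N * M * T) * (√(N * K * M ^ 2 * T) + L ^ 4 * K ^ 2 * T * ε) := by
  set l := Real.log (N * M * T) with hl
  set s := √(N * K * M ^ 2 * T) with hs
  have hs0 : 0 ≤ s := Real.sqrt_nonneg _
  have he0 : 0 ≤ L ^ 4 * K ^ 2 * T * ε := by positivity
  rcases le_total N (K * T) with hNK | hNK
  · have h1 : N * M ≤ s := by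
      refine Real.le_sqrt_of_sq_le ?_
      have : N * M ^ 2 * N ≤ N * M ^ 2 * (K * T) := by gcongr
      nlinarith
    have h2 : √(N * K * M ^ 2 * T * l) ≤ s * l := by
      rw [Real.sqrt_mul (by positivity)]
      gcongr
      exact Real.sqrt_le_self_iff.2 (Or.inr hlog)
    have h3 : Real.log (M + 1) ≤ l := by
      refine Real.log_le_log (by linarith) ?_
      have h4 : N * M * 1 ≤ N * M * T := by gcongr
      nlinarith
    have hKL : 1 ≤ K ^ 2 * L ^ 4 :=
      one_le_mul_of_one_le_of_one_le (one_le_pow₀ hK) (one_le_pow₀ hL)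
    have h4 : T * ε * (K ^ 2 * L ^ 4 * Real.log (M + 1) + 2)
        ≤ 3 * (l * (L ^ 4 * K ^ 2 * T * ε)) := by
      have h5 : K ^ 2 * L ^ 4 * Real.log (M + 1) + 2 ≤ 3 * (K ^ 2 * L ^ 4 * l) := by
        have h6 : K ^ 2 * L ^ 4 * Real.log (M + 1) ≤ K ^ 2 * L ^ 4 * l := by gcongr
        have h7 : 1 ≤ K ^ 2 * L ^ 4 * l := one_le_mul_of_one_le_of_one_le hKL hlog
        linarith
      calc T * ε * (K ^ 2 * L ^ 4 * Real.log (M + 1) + 2)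
          ≤ T * ε * (3 * (K ^ 2 * L ^ 4 * l)) := by gcongr
        _ = 3 * (l * (L ^ 4 * K ^ 2 * T * ε)) := by ring
    have h5 : s ≤ l * s := le_mul_of_one_le_left hs0 hlog
    have h6 : 4 ≤ N * M := by nlinarith
    have h7 : 0 ≤ l * (L ^ 4 * K ^ 2 * T * ε) := by positivity
    nlinarith
  · have h1 : T ≤ s := by
      refine Real.le_sqrt_of_sq_le ?_
      have hTN : T ≤ N := le_trans (by nlinarith) hNK
      have h8 : 1 ≤ K * M ^ 2 := one_le_mul_of_one_le_of_one_le hK (one_le_pow₀ (by linarith))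
      have h9 : T * T ≤ N * T := by gcongr
      have h10 : N * T * 1 ≤ N * T * (K * M ^ 2) := by gcongr
      nlinarith
    have h5 : s ≤ l * s := le_mul_of_one_le_left hs0 hlog
    have h7 : 0 ≤ l * (L ^ 4 * K ^ 2 * T * ε) := by positivity
    nlinarith

/-- For the calibrated granularity `e` and the target rate `Z`, one has `e Z = √(N K T)` and `L⁴ K²
T e = Z`. As `M e ≤ 2 / c₁`, both terms of the order bound are multiples of `Z`. -/
lemma rate_bound {N M K T ε L R c₁ c₂ : ℝ} (hN : 3 ≤ N) (hM : 3 ≤ M) (hK : 1 ≤ K) (hT : 1 ≤ T)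
    (hε : 0 < ε) (hL : 1 ≤ L) (hMε : M ≤ 2 / ε) (hc₁ : 0 < c₁)
    (hR : R ≤ 17 * Real.log (N * M * T) * (√(N * K * M ^ 2 * T) + L ^ 4 * K ^ 2 * T * ε))
    (h₁ : c₁ * (L ^ (-2 : ℝ) * K ^ (-(3 / 4) : ℝ) * N ^ (1 / 4 : ℝ) * T ^ (-(1 / 4) : ℝ)) ≤ ε)
    (h₂ : ε ≤ c₂ * (L ^ (-2 : ℝ) * K ^ (-(3 / 4) : ℝ) * N ^ (1 / 4 : ℝ) * T ^ (-(1 / 4) : ℝ))) :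
    R ≤ 17 * (|Real.log (2 / c₁)| + 3) * (2 / c₁ + c₂) * Real.log (L * N * K * T)
      * (L ^ 2 * N ^ (1 / 4 : ℝ) * K ^ (5 / 4 : ℝ) * T ^ (3 / 4 : ℝ)) := by
  have hL0 : 0 < L := by linarith
  have hK0 : 0 < K := by linarith
  have hN0 : 0 < N := by linarith
  have hT0 : 0 < T := by linarith
  set e := L ^ (-2 : ℝ) * K ^ (-(3 / 4) : ℝ) * N ^ (1 / 4 : ℝ) * T ^ (-(1 / 4) : ℝ) with he
  set Z := L ^ 2 * N ^ (1 / 4 : ℝ) * K ^ (5 / 4 : ℝ) * T ^ (3 / 4 : ℝ) with hZ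
  have he0 : 0 < e := by positivity
  have hZ0 : 0 < Z := by positivity
  have hc₂ : 0 < c₂ := by
    by_contra hneg
    nlinarith
  have hLL : L ^ (-2 : ℝ) * L ^ 2 = 1 := by
    rw [← Real.rpow_natCast L 2, ← Real.rpow_add hL0]; norm_num
  have heZ : e * Z = √(N * K * T) := by
    have hKK : K ^ (-(3 / 4) : ℝ) * K ^ (5 / 4 : ℝ) = K ^ (1 / 2 : ℝ) := by
      rw [← Real.rpow_add hK0]; norm_num
    have hNN : N ^ (1 / 4 : ℝ) * N ^ (1 / 4 : ℝ) = N ^ (1 / 2 : ℝ) := by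
      rw [← Real.rpow_add hN0]; norm_num
    have hTT : T ^ (-(1 / 4) : ℝ) * T ^ (3 / 4 : ℝ) = T ^ (1 / 2 : ℝ) := by
      rw [← Real.rpow_add hT0]; norm_num
    rw [Real.sqrt_eq_rpow, Real.mul_rpow (by positivity) hT0.le, Real.mul_rpow hN0.le hK0.le,
      ← hKK, ← hNN, ← hTT, he, hZ]
    linear_combination (N ^ (1 / 4 : ℝ) * N ^ (1 / 4 : ℝ) * (K ^ (-(3 / 4) : ℝ) * K ^ (5 / 4 : ℝ))
      * (T ^ (-(1 / 4) : ℝ) * T ^ (3 / 4 : ℝ))) * hLL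
  have hZe : L ^ 4 * K ^ 2 * T * e = Z := by
    have hKK : K ^ 2 * K ^ (-(3 / 4) : ℝ) = K ^ (5 / 4 : ℝ) := by
      rw [← Real.rpow_natCast K 2, ← Real.rpow_add hK0]; norm_num
    have hTT : T * T ^ (-(1 / 4) : ℝ) = T ^ (3 / 4 : ℝ) := by
      nth_rewrite 1 [← Real.rpow_one T]
      rw [← Real.rpow_add hT0]; norm_num
    rw [hZ, ← hKK, ← hTT, he]
    linear_combination (L ^ 2 * K ^ 2 * K ^ (-(3 / 4) : ℝ) * N ^ (1 / 4 : ℝ) * T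
      * T ^ (-(1 / 4) : ℝ)) * hLL
  have hMe : M * e ≤ 2 / c₁ := by
    calc M * e ≤ 2 / ε * (ε / c₁) := by
          gcongr
          rw [le_div_iff₀ hc₁]
          linarith
      _ = 2 / c₁ := by field_simp
  have hsqrt : √(N * K * M ^ 2 * T) ≤ 2 / c₁ * Z := by
    have : √(N * K * M ^ 2 * T) = M * e * Z := by
      rw [show N * K * M ^ 2 * T = M ^ 2 * (N * K * T) by ring, Real.sqrt_mul (sq_nonneg M),
        Real.sqrt_sq (by linarith), ← heZ]
      exact (mul_assoc M e Z).symm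
    rw [this]
    gcongr
  have hlin : L ^ 4 * K ^ 2 * T * ε ≤ c₂ * Z := by
    calc L ^ 4 * K ^ 2 * T * ε ≤ L ^ 4 * K ^ 2 * T * (c₂ * e) := by gcongr
      _ = c₂ * Z := by rw [← hZe]; ring
  set P := L * N * K * T with hP
  have hP3 : 3 ≤ P := by
    have h1 : 1 ≤ L * (K * T) :=
      one_le_mul_of_one_le_of_one_le hL (one_le_mul_of_one_le_of_one_le hK hT)
    nlinarith
  have hlogP : 1 ≤ Real.log P := by
    rw [Real.le_log_iff_exp_le (by linarith)]
    linarith [Real.exp_one_lt_d9]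
  have hZP : Z ≤ P ^ 2 := by
    have hpow : ∀ {x a : ℝ}, 1 ≤ x → a ≤ 2 → x ^ a ≤ x ^ 2 := by
      intro x a hx ha
      rw [← Real.rpow_natCast x 2]
      exact Real.rpow_le_rpow_of_exponent_le hx (by push_cast; exact ha)
    have h1 := hpow (show 1 ≤ N by linarith) (show (1 / 4 : ℝ) ≤ 2 by norm_num)
    have h2 := hpow hK (show (5 / 4 : ℝ) ≤ 2 by norm_num)
    have h3 := hpow hT (show (3 / 4 : ℝ) ≤ 2 by norm_num)
    calc Z ≤ L ^ 2 * N ^ 2 * K ^ 2 * T ^ 2 := by rw [hZ]; gcongr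
      _ = P ^ 2 := by rw [hP]; ring
  have heZ1 : 1 ≤ e * Z := by
    rw [heZ, Real.one_le_sqrt]
    exact one_le_mul_of_one_le_of_one_le
      (one_le_mul_of_one_le_of_one_le (by linarith) hK) hT
  -- A polynomial bound on `M`, needed only to remove it from the logarithm; it uses `e Z ≥ 1` and
  -- `Z ≤ P²`.
  have hMP : M ≤ 2 / c₁ * P ^ 2 := by
    calc M = M * 1 := (mul_one M).symm
      _ ≤ M * (e * Z) := by gcongr
      _ = M * e * Z := by ring
      _ ≤ 2 / c₁ * P ^ 2 := by gcongr
  have hNTP : N * T ≤ P := by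
    have h1 : 1 ≤ L * K := one_le_mul_of_one_le_of_one_le hL hK
    calc N * T = 1 * (N * T) := (one_mul _).symm
      _ ≤ L * K * (N * T) := by gcongr
      _ = P := by rw [hP]; ring
  have hlogle : Real.log (N * M * T) ≤ (|Real.log (2 / c₁)| + 3) * Real.log P := by
    have h1 : N * M * T ≤ 2 / c₁ * P ^ 3 := by
      calc N * M * T = M * (N * T) := by ring
        _ ≤ 2 / c₁ * P ^ 2 * P := by gcongr
        _ = 2 / c₁ * P ^ 3 := by ring
    have h2 := Real.log_le_log (by positivity) h1
    rw [Real.log_mul (x := 2 / c₁) (by positivity) (by positivity), Real.log_pow] at h2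
    have h3 := le_abs_self (Real.log (2 / c₁))
    have h4 : |Real.log (2 / c₁)| ≤ |Real.log (2 / c₁)| * Real.log P :=
      le_mul_of_one_le_right (abs_nonneg _) hlogP
    push_cast at h2
    linarith
  refine hR.trans ?_
  calc 17 * Real.log (N * M * T) * (√(N * K * M ^ 2 * T) + L ^ 4 * K ^ 2 * T * ε)
      ≤ 17 * ((|Real.log (2 / c₁)| + 3) * Real.log P) * (2 / c₁ * Z + c₂ * Z) := by gcongr
    _ = _ := by ring

end KMaxBandit

end

theorem theorem1 :
    ∃ (C₀ : ℝ) (C : ℝ → ℝ → ℝ), ∀ (N K T : ℕ) (L ε : ℝ),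
      1 < K → K < N → 1 ≤ T → 1 ≤ L → 0 < ε → ε < 1 / 2 →
      ∀ (D : Fin N → Measure ℝ) [∀ i, IsProbabilityMeasure (D i)],
      (∀ i, KMaxBandit.BiLipschitzOutcome L (D i)) →
      ∀ (oracle : (Fin N → Fin (KMaxBandit.numBins ε) → ℝ) → Finset (Fin N)),
      KMaxBandit.IsApproxOracle ε (1 - ε) K oracle →
      ∀ (Ω : Type*) [MeasurableSpace Ω] (μ : Measure Ω) [IsProbabilityMeasure μ]
        (X : ℕ → Fin N → Ω → ℝ) (win : ℕ → Finset (Fin N) → Ω → Fin N),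
      KMaxBandit.IsEnvironment μ D X win →
      ∀ (R : Ω → ℝ), (R = fun ω => KMaxBandit.pathRegret D K L ε oracle T
        (fun t i => X t i ω) (fun t S => win t S ω)) →
      ∀ (M : ℝ), M = (KMaxBandit.numBins ε : ℝ) →
      -- the regret is a well-defined expectation
      Integrable R μ ∧
      -- the explicit bound
      (∫ ω, R ω ∂μ ≤
        12289 * √(N * K * M ^ 2 * T * Real.log (N * M * T))
          + T * ε * (4 * K ^ 2 * L ^ 4 * Real.log (M + 1) + 3)
          + 16 * N * M
          + Real.pi ^ 2 * (Real.logb 2 (√(K * M ^ 2 * T * Real.log (N * M * T) / N)) + 5) / 6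
          + (T : ℝ)⁻¹) ∧
      -- its order, with a universal constant
      (∫ ω, R ω ∂μ ≤
        C₀ * Real.log (N * M * T) * (√(N * K * M ^ 2 * T) + L ^ 4 * K ^ 2 * T * ε)) ∧
      -- the rate, for a calibrated granularity
      (∀ c₁ c₂ : ℝ, 0 < c₁ →
        c₁ * (L ^ (-2 : ℝ) * (K : ℝ) ^ (-(3 / 4) : ℝ) * (N : ℝ) ^ (1 / 4 : ℝ)
          * (T : ℝ) ^ (-(1 / 4) : ℝ)) ≤ ε →
        ε ≤ c₂ * (L ^ (-2 : ℝ) * (K : ℝ) ^ (-(3 / 4) : ℝ) * (N : ℝ) ^ (1 / 4 : ℝ)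
          * (T : ℝ) ^ (-(1 / 4) : ℝ)) →
        ∫ ω, R ω ∂μ ≤
          C c₁ c₂ * Real.log (L * N * K * T)
            * (L ^ 2 * (N : ℝ) ^ (1 / 4 : ℝ) * (K : ℝ) ^ (5 / 4 : ℝ)
              * (T : ℝ) ^ (3 / 4 : ℝ))) := by
  refine ⟨17, fun c₁ c₂ => 17 * (|Real.log (2 / c₁)| + 3) * (2 / c₁ + c₂), ?_⟩
  intro N K T L ε hK hKN hT hL hε hε2 D _ hD oracle ho Ω _ μ _ X win h R hR M hM
  obtain ⟨hint, hRT, hRB⟩ :=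
    h.pathRegret_bounds hD hL hε (by linarith) hK hKN.le hT ho (T := T)
  have hN3 : (3 : ℝ) ≤ N := by exact_mod_cast (by omega : 3 ≤ N)
  have hK1 : (1 : ℝ) ≤ K := by exact_mod_cast hK.le
  have hT1 : (1 : ℝ) ≤ T := by exact_mod_cast hT
  -- The assumption `ε < 1 / 2` gives at least three bins, and lets the rounding in `⌈1 / ε⌉` be
  -- absorbed into `M ≤ 2 / ε`.
  have hinv : 2 < 1 / ε := by rw [lt_div_iff₀ hε]; linarith
  have hM3 : (3 : ℝ) ≤ M := by
    have h2 : 2 < KMaxBandit.numBins ε := Nat.lt_ceil.2 (by exact_mod_cast hinv)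
    rw [hM]
    exact_mod_cast h2
  have hM2 : M ≤ 2 / ε := by
    have h1 : M < 1 / ε + 1 := hM ▸ Nat.ceil_lt_add_one (by positivity)
    have h2 : 2 / ε = 1 / ε + 1 / ε := by ring
    linarith
  have hlog : 1 ≤ Real.log (N * M * T) := by
    have h9 : 3 ≤ N * M * T := by
      have : 9 ≤ N * M := by nlinarith
      nlinarith
    rw [Real.le_log_iff_exp_le (by linarith)]
    linarith [Real.exp_one_lt_d9]
  rw [← hR, ← hM] at hRB
  rw [← hR] at hint hRT
  have horder := KMaxBandit.order_bound hN3 hM3 hK1 hT1 hε hL hlog hRT hRB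
  exact ⟨hint, KMaxBandit.explicit_bound hN3 hM3 hK1 hT1 hε hlog hRB, horder,
    fun c₁ c₂ hc₁ h₁ h₂ =>
      KMaxBandit.rate_bound hN3 hM3 hK1 hT1 hε hL hM2 hc₁ horder h₁ h₂⟩
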